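/- Let $\Bbbk$ be a field and let $H$ be a Hopf algebra over $\Bbbk$ with comultiplication $\Delta(b)=b_1\otimes b_2$ (Sweedler notation), counit $\varepsilon$ and antipode $S$. No noetherian hypothesis is made on $H$, and $S$ is not assumed to be bijective. Let $H^e=H\otimes_{\Bbbk} H^{\mathrm{op}}$ be the enveloping algebra, so that $H$-bimodules are the same as left $H^e$-modules via $(a\otimes b)\cdot m=amb$, and let ${}_\varepsilon\Bbbk$ and $\Bbbk_\varepsilon$ be the left and right trivial $H$-modules given by $\varepsilon$. Assume that at least one of the following (equivalent) conditions holds: $H$ has a (possibly infinite) resolution by finitely generated projective left $H^e$-modules; ${}_\varepsilon\Bbbk$ has a resolution by finitely generated projective left $H$-modules; $\Bbbk_\varepsilon$ has a resolution by finitely generated projective right $H$-modules. Then for every integer $i\ge 0$ there are isomorphisms of $H$-bimodules $$\operatorname{Ext}^i_{H^e}(H,H^e)\;\cong\;\operatorname{Ext}^i_H({}_\varepsilon\Bbbk,H)\otimes_{\Bbbk} H\;\cong\; H\otimes_{\Bbbk} \operatorname{Ext}^i_{H^{\mathrm{op}}}(\Bbbk_\varepsilon,H),$$ with the following bimodule structures.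 On the first term, $\operatorname{Ext}$ is taken with respect to the left $H^e$-module structure $(a\otimes b)(x\otimes y)=ax\otimes yb$ of $H^e$, and the bimodule structure $b\,m\,a=m\cdot(a\otimes b)$ is induced by the right action $(x\otimes y)(a\otimes b)=xa\otimes by$ of $H^e$ on itself. On the second term (also written $\operatorname{Ext}^i_H({}_\varepsilon\Bbbk,H)\otimes H^{S^2}$), $a(x\otimes y)b=xb_1\otimes a\,y\,S^2(b_2)$, where $\operatorname{Ext}^i_H({}_\varepsilon\Bbbk,H)$ is a right $H$-module through right multiplication on $H$. On the third term (also written ${}^{S^2}H\otimes\operatorname{Ext}^i_{H^{\mathrm{op}}}(\Bbbk_\varepsilon,H)$), $a(x\otimes y)b=S^2(a_1)\,x\,b\otimes a_2y$, where $\operatorname{Ext}^i_{H^{\mathrm{op}}}(\Bbbk_\varepsilon,H)$, the Ext of right $H$-modules, is a left $H$-module through left multiplication on $H$. -/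

import Mathlib

open CategoryTheory CategoryTheory.Abelian TensorProduct MulOpposite

universe u

noncomputable section

namespace HopfBimodule

/-- The enveloping algebra `A ⊗ Aᵒᵖ`. An `A`-bimodule is a left module over it, with
`(a ⊗ b) · m = a m b`. -/
abbrev Env (k : Type u) (A : Type u) [Field k] [Ring A] [Algebra k A] : Type u := A ⊗[k] Aᵐᵒᵖ

/-- The left `A`-module given by a representation of `A` on the vector space `V`. -/
def ofRep {k A V : Type u} [Field k] [Ring A] [Algebra k A] [AddCommGroup V] [Module k V]
    (ρ : A →ₐ[k] Module.End k V) : ModuleCat.{u} A :=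
  (ModuleCat.restrictScalars ρ.toRingHom).obj (ModuleCat.of (Module.End k V) V)

/-- A module has a (possibly infinite) resolution by finitely generated projective modules. -/
def HasFGProjectiveResolution {R : Type u} [Ring R] (M : ModuleCat.{u} R) : Prop :=
  ∃ P : ProjectiveResolution M, ∀ n : ℕ, Module.Finite R (P.complex.X n)

section Ext

variable {k R : Type u} [Field k] [Ring R] [Algebra k R]

lemma smul_hom_apply {M N : ModuleCat.{u} R} (c : k) (f : M ⟶ N) (y : M) :
    (c • f).hom y = algebraMap k R c • f.hom y := rfl

/-- Multiplication by `t ∈ T`, as an `R`-linear endomorphism of `Y`, when the actions of `R` and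
of `T` on `Y` commute. -/
def actHom (R : Type u) [Ring R] {T Y : Type u} [Ring T] [AddCommGroup Y] [Module R Y] [Module T Y]
    [SMulCommClass R T Y] [SMulCommClass T R Y] (t : T) : ModuleCat.of R Y ⟶ ModuleCat.of R Y :=
  ModuleCat.ofHom (Module.toModuleEnd R Y t)

/-- If `Y` carries commuting (left) actions of the `k`-algebras `R` and `T`, then `T` acts on
`Ext^n_R(X, Y)` by functoriality in `Y`. With `T` replaced by an opposite algebra this is the usual
right module structure on `Ext^n_R(X, Y)` for an `R`-`T`-bimodule `Y`. -/
def extRep (X : ModuleCat.{u} R) (T Y : Type u) [Ring T] [Algebra k T] [AddCommGroup Y]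
    [Module k Y] [Module R Y] [Module T Y] [IsScalarTower k R Y] [IsScalarTower k T Y]
    [SMulCommClass R T Y] [SMulCommClass T R Y] (n : ℕ) :
    T →ₐ[k] Module.End k (Ext X (ModuleCat.of R Y) n) :=
  AlgHom.ofLinearMap
    { toFun := fun t => Ext.postcompOfLinear (Ext.mk₀ (actHom R t)) k X (add_zero n)
      map_add' := fun s t => by
        have h : actHom R (Y := Y) (s + t) = actHom R s + actHom R t := by
          ext y; exact add_smul s t y
        ext e
        simp [h, Ext.mk₀_add]
      map_smul' := fun c t => by
        ext e
        change e.comp (Ext.mk₀ (actHom R (c • t))) (add_zero n) =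
          c • e.comp (Ext.mk₀ (actHom R t)) (add_zero n)
        rw [← Ext.comp_smul, ← Ext.mk₀_smul]
        congr 2
        ext y
        change (c • t) • y = _
        rw [smul_hom_apply]
        change (c • t) • y = algebraMap k R c • t • y
        rw [smul_assoc, algebraMap_smul] }
    (by
      have h : actHom R (1 : T) = 𝟙 (ModuleCat.of R Y) := by
        ext y; exact one_smul T y
      ext e
      simp [h])
    (fun s t => by
      have h : actHom R (Y := Y) (s * t) = actHom R t ≫ actHom R s := by
        ext y; exact mul_smul s t y
      ext e
      simp [h, ← Ext.mk₀_comp_mk₀])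

lemma extRep_apply (X : ModuleCat.{u} R) (T Y : Type u) [Ring T] [Algebra k T] [AddCommGroup Y]
    [Module k Y] [Module R Y] [Module T Y] [IsScalarTower k R Y] [IsScalarTower k T Y]
    [SMulCommClass R T Y] [SMulCommClass T R Y] (n : ℕ) (t : T) (e : Ext X (ModuleCat.of R Y) n) :
    extRep (k := k) X T Y n t e = e.comp (Ext.mk₀ (actHom R t)) (add_zero n) := rfl

end Ext

section Enveloping

variable (k A : Type u) [Field k] [Ring A] [Algebra k A]

/-- `A` as an `A`-bimodule. -/
def regularBimodule : ModuleCat.{u} (Env k A) := ofRep (AlgHom.mulLeftRight k A)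

/-- The isomorphism of the enveloping algebra with its opposite, exchanging the factors:
`a ⊗ b ↦ b ⊗ a`. -/
def envFlip : Env k A →ₐ[k] (Env k A)ᵐᵒᵖ :=
  ((Algebra.TensorProduct.opAlgEquiv k k A Aᵐᵒᵖ).toAlgHom.comp
    (Algebra.TensorProduct.map (AlgHom.id k Aᵐᵒᵖ) (AlgEquiv.opOp k A).toAlgHom)).comp
    (Algebra.TensorProduct.comm k A Aᵐᵒᵖ).toAlgHom

lemma envFlip_tmul (a b : A) : envFlip k A (a ⊗ₜ op b) = op (b ⊗ₜ op a) := rfl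

/-- `Ext^n_{A^e}(A, A^e)` as an `A`-bimodule. The `Ext` is taken for the outer (left) action
`(a ⊗ b)(x ⊗ y) = ax ⊗ yb` of `A^e` on itself; the inner (right) action
`(x ⊗ y)(a ⊗ b) = xa ⊗ by` makes it a right `A^e`-module, which is turned into an `A`-bimodule by
`b m a = m · (a ⊗ b)`. -/
def hochschildBimodule (n : ℕ) : ModuleCat.{u} (Env k A) :=
  ofRep ((extRep (k := k) (regularBimodule k A) (Env k A)ᵐᵒᵖ (Env k A) n).comp (envFlip k A))

end Enveloping

section Hopf

variable (k H : Type u) [Field k] [Ring H] [HopfAlgebra k H]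

/-- The left trivial module: `k` with `a · c = ε(a) c`. -/
def leftTrivial : ModuleCat.{u} H :=
  ofRep ((Algebra.lmul k k).comp (Bialgebra.counitAlgHom k H))

/-- The right trivial module: `k` with `c · a = c ε(a)`. Right `H`-modules are left modules over
the opposite algebra. -/
def rightTrivial : ModuleCat.{u} Hᵐᵒᵖ :=
  ofRep ((Algebra.lmul k k).comp
    ((Bialgebra.counitAlgHom k H).fromOpposite fun _ _ => Commute.all _ _))

/-- The square of the antipode, as an algebra endomorphism. -/
def antipodeSq : H →ₐ[k] H :=
  AlgHom.ofLinearMap (HopfAlgebra.antipode k ∘ₗ HopfAlgebra.antipode k)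
    (by simp) (by simp [HopfAlgebra.antipode_mul_antidistrib])

@[simp]
lemma antipodeSq_apply (a : H) :
    antipodeSq k H a = HopfAlgebra.antipode k (HopfAlgebra.antipode k a) := rfl

/-- `Ext^n_H(εk, H)` with its right `H`-module structure coming from right multiplication on
`H`. -/
def leftExtRep (n : ℕ) :
    Hᵐᵒᵖ →ₐ[k] Module.End k (Ext (leftTrivial k H) (ModuleCat.of H H) n) :=
  extRep (leftTrivial k H) Hᵐᵒᵖ H n

/-- `Ext^n_{Hᵒᵖ}(k_ε, H)` (in the category of right `H`-modules) with its left `H`-module structure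
coming from left multiplication on `H`. -/
def rightExtRep (n : ℕ) :
    H →ₐ[k] Module.End k (Ext (rightTrivial k H) (ModuleCat.of Hᵐᵒᵖ H) n) :=
  extRep (rightTrivial k H) H H n

variable {k H}
variable {E : Type u} [AddCommGroup E] [Module k E]

/-- The left action `a (x ⊗ y) = x ⊗ a y` on `E ⊗ H`. -/
def mulLeftOp (E : Type u) [AddCommGroup E] [Module k E] : H →ₐ[k] Module.End k (E ⊗[k] H) :=
  (Module.End.lTensorAlgHom k H E).comp (Algebra.lmul k H)

lemma mulLeftOp_tmul (a y : H) (x : E) : mulLeftOp E a (x ⊗ₜ[k] y) = x ⊗ₜ[k] (a * y) := rfl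

/-- The right action `(x ⊗ y) b = x b ⊗ y` on `H ⊗ E`. -/
def mulRightOp (E : Type u) [AddCommGroup E] [Module k E] : Hᵐᵒᵖ →ₐ[k] Module.End k (H ⊗[k] E) :=
  (Module.End.rTensorAlgHom k H E).comp (Algebra.lsmul k k H)

lemma mulRightOp_tmul (b x : H) (y : E) :
    mulRightOp E (op b) (x ⊗ₜ[k] y) = (x * b) ⊗ₜ[k] y := rfl

/-- The right action `(x ⊗ y) b = x b₁ ⊗ y S²(b₂)` on `E ⊗ H`, for a right `H`-module `E`. -/
def twistRightOp (σ : Hᵐᵒᵖ →ₐ[k] Module.End k E) : Hᵐᵒᵖ →ₐ[k] Module.End k (E ⊗[k] H) :=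
  ((Module.endTensorEndAlgHom (R := k) (S := k) (A := k) (M := E) (N := H)).comp
    (Algebra.TensorProduct.map σ ((Algebra.lsmul k k H).comp (antipodeSq k H).op))).comp
    ((Algebra.TensorProduct.opAlgEquiv k k H H).symm.toAlgHom.comp
      (Bialgebra.comulAlgHom k H).op)

lemma twistRightOp_tmul (σ : Hᵐᵒᵖ →ₐ[k] Module.End k E) (b : H) {ι : Type*}
    (r : Coalgebra.Repr k b ι) (x : E) (y : H) :
    twistRightOp σ (op b) (x ⊗ₜ y) =
      ∑ i ∈ r.index, σ (op (r.left i)) x ⊗ₜ[k]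
        (y * HopfAlgebra.antipode k (HopfAlgebra.antipode k (r.right i))) := by
  have h : (Bialgebra.comulAlgHom k H).op (op b) =
      ∑ i ∈ r.index, op (r.left i ⊗ₜ[k] r.right i) := by
    rw [AlgHom.op_apply_apply, unop_op, Bialgebra.comulAlgHom_apply, ← r.eq]
    exact map_sum (opAddEquiv : H ⊗[k] H ≃+ (H ⊗[k] H)ᵐᵒᵖ) _ _
  simp [twistRightOp, h, Module.endTensorEndAlgHom_apply]

/-- The left action `a (x ⊗ y) = S²(a₁) x ⊗ a₂ y` on `H ⊗ E`, for a left `H`-module `E`. -/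
def twistLeftOp (σ : H →ₐ[k] Module.End k E) : H →ₐ[k] Module.End k (H ⊗[k] E) :=
  ((Module.endTensorEndAlgHom (R := k) (S := k) (A := k) (M := H) (N := E)).comp
    (Algebra.TensorProduct.map ((Algebra.lmul k H).comp (antipodeSq k H)) σ)).comp
    (Bialgebra.comulAlgHom k H)

lemma twistLeftOp_tmul (σ : H →ₐ[k] Module.End k E) (a : H) {ι : Type*}
    (r : Coalgebra.Repr k a ι) (x : H) (y : E) :
    twistLeftOp σ a (x ⊗ₜ y) =
      ∑ i ∈ r.index, (HopfAlgebra.antipode k (HopfAlgebra.antipode k (r.left i)) * x) ⊗ₜ[k]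
        σ (r.right i) y := by
  have h : Bialgebra.comulAlgHom k H a = ∑ i ∈ r.index, r.left i ⊗ₜ[k] r.right i := by
    rw [Bialgebra.comulAlgHom_apply, ← r.eq]
  simp [twistLeftOp, h, Module.endTensorEndAlgHom_apply]

lemma twistRight_commute (σ : Hᵐᵒᵖ →ₐ[k] Module.End k E) (a : H) (b : Hᵐᵒᵖ) :
    Commute (mulLeftOp E a)
      (twistRightOp σ b) := by
  induction b using MulOpposite.rec' with
  | _ b =>
  refine TensorProduct.ext' fun x y => ?_
  simp [twistRightOp_tmul σ b (Coalgebra.Repr.arbitrary k b), mulLeftOp_tmul, mul_assoc]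

lemma twistLeft_commute (σ : H →ₐ[k] Module.End k E) (a : H) (b : Hᵐᵒᵖ) :
    Commute (twistLeftOp σ a)
      (mulRightOp E b) := by
  induction b using MulOpposite.rec' with
  | _ b =>
  refine TensorProduct.ext' fun x y => ?_
  simp [twistLeftOp_tmul σ a (Coalgebra.Repr.arbitrary k a), mulRightOp_tmul, mul_assoc]

/-- For a right `H`-module `E`, the bimodule structure on `E ⊗ H` given by
`a (x ⊗ y) b = x b₁ ⊗ a y S²(b₂)`. -/
def twistRightRep (σ : Hᵐᵒᵖ →ₐ[k] Module.End k E) : Env k H →ₐ[k] Module.End k (E ⊗[k] H) :=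
  Algebra.TensorProduct.lift
    (mulLeftOp E)
    (twistRightOp σ)
    (fun a b => twistRight_commute σ a b)

/-- For a left `H`-module `E`, the bimodule structure on `H ⊗ E` given by
`a (x ⊗ y) b = S²(a₁) x b ⊗ a₂ y`. -/
def twistLeftRep (σ : H →ₐ[k] Module.End k E) : Env k H →ₐ[k] Module.End k (H ⊗[k] E) :=
  Algebra.TensorProduct.lift
    (twistLeftOp σ)
    (mulRightOp E)
    (fun a b => twistLeft_commute σ a b)

lemma twistRightRep_tmul (σ : Hᵐᵒᵖ →ₐ[k] Module.End k E) (a b : H) {ι : Type*}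
    (r : Coalgebra.Repr k b ι) (x : E) (y : H) :
    twistRightRep σ (a ⊗ₜ op b) (x ⊗ₜ y) =
      ∑ i ∈ r.index, σ (op (r.left i)) x ⊗ₜ[k]
        (a * y * HopfAlgebra.antipode k (HopfAlgebra.antipode k (r.right i))) := by
  simp [twistRightRep, twistRightOp_tmul σ b r, mulLeftOp_tmul, mul_assoc]

lemma twistLeftRep_tmul (σ : H →ₐ[k] Module.End k E) (a b : H) {ι : Type*}
    (r : Coalgebra.Repr k a ι) (x : H) (y : E) :
    twistLeftRep σ (a ⊗ₜ op b) (x ⊗ₜ y) =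
      ∑ i ∈ r.index, (HopfAlgebra.antipode k (HopfAlgebra.antipode k (r.left i)) * x * b) ⊗ₜ[k]
        σ (r.right i) y := by
  rw [twistLeftRep, Algebra.TensorProduct.lift_tmul, Module.End.mul_apply]
  simp [twistLeftOp_tmul σ a r, mulRightOp_tmul, mul_assoc]

variable (k H)

/-- The `H`-bimodule `Ext^n_H(εk, H) ⊗ H^{S²}`, with `a (x ⊗ y) b = x b₁ ⊗ a y S²(b₂)`. -/
def leftExtBimodule (n : ℕ) : ModuleCat.{u} (Env k H) :=
  ofRep (twistRightRep (leftExtRep k H n))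

/-- The `H`-bimodule `^{S²}H ⊗ Ext^n_{Hᵒᵖ}(k_ε, H)`, with `a (x ⊗ y) b = S²(a₁) x b ⊗ a₂ y`. -/
def rightExtBimodule (n : ℕ) : ModuleCat.{u} (Env k H) :=
  ofRep (twistLeftRep (rightExtRep k H n))

end Hopf

end HopfBimodule

end

/-!
The `Ext` groups over `H^e` and over `H` are compared through an exact functor between the two
module categories. An algebra homomorphism `A → R ⊗ End W` makes `N ⊗ W` an `A`-module for every
`R`-module `N` (`tensorFunctor`). For a left `H`-module `N`, the homomorphism
`a ⊗ b ↦ a₁ ⊗ (y ↦ a₂ y b)` (`leftAct`) makes `N ⊗ H` a bimodule, and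

* `k ⊗ H` is the regular bimodule (`leftTrivialIso`);
* `H ⊗ H` is a free bimodule on `1 ⊗ 1`, since `x ⊗ y ↦ x₁ ⊗ x₂ y` is bijective with inverse
  `x ⊗ y ↦ x₁ ⊗ S(x₂) y`. In particular `x ⊗ 1 = β(x) · (1 ⊗ 1)` with `β(x) = x₁ ⊗ S(x₂)`.

Every `v ∈ H` gives a bimodule homomorphism `H ⊗ H → H^e` sending `1 ⊗ 1` to `φ(v) = 1 ⊗ v`, and
composing with it yields the comparison map
`Ext^n_H(N, H) ⊗ H → Ext^n_{H^e}(N ⊗ H, H^e)`, `e ⊗ v ↦ φ(v) ∘ (e ⊗ H)` (`extCompare`).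
For `N = H` and `n = 0` this is the map `x ⊗ v ↦ β(x) φ(v) = x₁ ⊗ v S(x₂)`, which is bijective
with inverse `x ⊗ v ↦ x₁ ⊗ v S²(x₂)`; this is where `S²` comes from, and no inverse of `S` is
needed. By dimension shifting the comparison map is then bijective for every `N` of type `FP_∞`
(`extCompare_bijective`). The identity `φ(v) (b ⊗ a) = ∑ β(b₁) φ(a v S²(b₂))` (`leftPhi_mul`) says
that the bimodule structure of the target corresponds to the twisted one of the source
(`ComparisonData.compare_comp`).

The mirror argument for right modules uses `a (n ⊗ y) b = n b₂ ⊗ a y b₁` on `N ⊗ H`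
(`rightAct`), `β(x) = S(x₁) ⊗ x₂` and `φ(v) = v ⊗ 1`. The properties shared by the two cases are
isolated in `ComparisonData`.

The three finiteness hypotheses agree (`isFP_leftTrivial_iff`, `isFP_rightTrivial_iff`): a
resolution by finitely generated projectives makes a module of type `FPₙ` for all `n`, and
`N ↦ N ⊗ W` preserves and reflects this property. It does because it is exact, takes `R` to a
finitely generated projective module, and reflects finite generation; Schanuel's lemma makes the
choice of presentations irrelevant.
-/

noncomputable section

namespace HopfBimodule

/-! ### Modules of type `FPₙ` -/

section FP

variable {R : Type u} [Ring R]

/-- A module is of type `FPₙ` if it is finitely generated and, for `n > 0`, is a quotient of a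
finitely generated free module by a submodule of type `FPₙ₋₁`. -/
def IsFP (R : Type u) [Ring R] : ℕ → ∀ (M : Type u) [AddCommGroup M] [Module R M], Prop
  | 0, M, _, _ => Module.Finite R M
  | n + 1, M, _, _ => ∃ (m : ℕ) (f : (Fin m → R) →ₗ[R] M),
      Function.Surjective f ∧ IsFP R n (LinearMap.ker f)

variable {M N P Q : Type u} [AddCommGroup M] [Module R M] [AddCommGroup N] [Module R N]
  [AddCommGroup P] [Module R P] [AddCommGroup Q] [Module R Q]

lemma IsFP.of_equiv {n : ℕ} (h : IsFP R n M) (e : M ≃ₗ[R] N) : IsFP R n N := by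
  cases n with
  | zero =>
    have : Module.Finite R M := h
    exact Module.Finite.equiv e
  | succ n =>
    obtain ⟨m, f, hf, h⟩ := h
    refine ⟨m, e.toLinearMap ∘ₗ f, e.surjective.comp hf, ?_⟩
    rwa [LinearEquiv.ker_comp]

lemma IsFP.finite {n : ℕ} (h : IsFP R n M) : Module.Finite R M := by
  cases n with
  | zero => exact h
  | succ n =>
    obtain ⟨m, f, hf, -⟩ := h
    exact Module.Finite.of_surjective f hf

/-- A splitting of a surjection onto a projective module; it depends on the choice of a section. -/
def kerProdEquiv [Module.Projective R P] (q : M →ₗ[R] P) (hq : Function.Surjective q) :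
    (LinearMap.ker q × P) ≃ₗ[R] M :=
  let s := (Module.projective_lifting_property q LinearMap.id hq).choose
  have hs : ∀ p, q (s p) = p := fun p =>
    LinearMap.congr_fun (Module.projective_lifting_property q LinearMap.id hq).choose_spec p
  LinearEquiv.ofBijective ((LinearMap.ker q).subtype.coprod s) <| by
    constructor
    · rw [← LinearMap.ker_eq_bot, LinearMap.ker_eq_bot']
      rintro ⟨⟨x, hx⟩, p⟩ h
      have hx' : q x = 0 := hx
      have h' : x + s p = 0 := h
      have hp : p = 0 := by
        have := congrArg q h'
        rwa [map_add, hx', hs, zero_add, map_zero] at this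
      subst hp
      rw [map_zero, add_zero] at h'
      subst h'
      rfl
    · intro x
      exact ⟨(⟨x - s (q x), by simp [hs]⟩, q x), by simp⟩

/-- Schanuel's lemma. Both sides are isomorphic to the pullback of `f` and `g`. -/
lemma exists_schanuel [Module.Projective R P] [Module.Projective R Q]
    (f : P →ₗ[R] M) (hf : Function.Surjective f) (g : Q →ₗ[R] M) (hg : Function.Surjective g) :
    Nonempty ((LinearMap.ker f × Q) ≃ₗ[R] (LinearMap.ker g × P)) := by
  let X : Submodule R (P × Q) :=
    LinearMap.ker (f ∘ₗ LinearMap.fst R P Q - g ∘ₗ LinearMap.snd R P Q)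
  have hX : ∀ x : P × Q, x ∈ X ↔ f x.1 = g x.2 := fun x => by simp [X, sub_eq_zero]
  let p : X →ₗ[R] P := LinearMap.fst R P Q ∘ₗ X.subtype
  let q : X →ₗ[R] Q := LinearMap.snd R P Q ∘ₗ X.subtype
  have hp : Function.Surjective p := fun x => by
    obtain ⟨y, hy⟩ := hg (f x)
    exact ⟨⟨(x, y), (hX _).2 hy.symm⟩, rfl⟩
  have hq : Function.Surjective q := fun y => by
    obtain ⟨x, hx⟩ := hf (g y)
    exact ⟨⟨(x, y), (hX _).2 hx⟩, rfl⟩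
  let ep : LinearMap.ker p ≃ₗ[R] LinearMap.ker g := LinearEquiv.ofBijective
    ((q ∘ₗ (LinearMap.ker p).subtype).codRestrict (LinearMap.ker g) fun x => by
      have h1 := (hX _).1 x.1.2
      have h2 : x.1.1.1 = 0 := x.2
      rw [h2, map_zero] at h1
      exact h1.symm)
    ⟨fun x y h => by
      have h1 : x.1.1.1 = 0 := x.2
      have h2 : y.1.1.1 = 0 := y.2
      have h3 : x.1.1.2 = y.1.1.2 := congrArg Subtype.val h
      exact Subtype.ext (Subtype.ext (Prod.ext (h1.trans h2.symm) h3)),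
    fun y => ⟨⟨⟨(0, y.1), (hX _).2 (by simp)⟩, rfl⟩, rfl⟩⟩
  let eq : LinearMap.ker q ≃ₗ[R] LinearMap.ker f := LinearEquiv.ofBijective
    ((p ∘ₗ (LinearMap.ker q).subtype).codRestrict (LinearMap.ker f) fun x => by
      have h1 := (hX _).1 x.1.2
      have h2 : x.1.1.2 = 0 := x.2
      rw [h2, map_zero] at h1
      exact h1)
    ⟨fun x y h => by
      have h1 : x.1.1.2 = 0 := x.2
      have h2 : y.1.1.2 = 0 := y.2
      have h3 : x.1.1.1 = y.1.1.1 := congrArg Subtype.val h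
      exact Subtype.ext (Subtype.ext (Prod.ext h3 (h1.trans h2.symm))),
    fun y => ⟨⟨⟨(y.1, 0), (hX _).2 (by simp)⟩, rfl⟩, rfl⟩⟩
  exact ⟨(eq.symm.prodCongr (LinearEquiv.refl R Q)).trans ((kerProdEquiv q hq).trans
    ((kerProdEquiv p hp).symm.trans (ep.prodCongr (LinearEquiv.refl R P))))⟩

lemma finite_projective_ker [Module.Finite R M] [Module.Projective R M]
    [Module.Projective R P] (q : M →ₗ[R] P) (hq : Function.Surjective q) :
    Module.Finite R (LinearMap.ker q) ∧ Module.Projective R (LinearMap.ker q) := by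
  let e := kerProdEquiv q hq
  have h1 : (LinearMap.fst R _ _ ∘ₗ e.symm.toLinearMap) ∘ₗ
      (e.toLinearMap ∘ₗ LinearMap.inl R _ _) = LinearMap.id := by
    ext x; simp
  refine ⟨Module.Finite.of_surjective (LinearMap.fst R _ _ ∘ₗ e.symm.toLinearMap)
    (Prod.fst_surjective.comp e.symm.surjective), Module.Projective.of_split _ _ h1⟩

lemma IsFP.prod {n : ℕ} (h : IsFP R n M) (P : Type u) [AddCommGroup P] [Module R P]
    [Module.Finite R P] [Module.Projective R P] : IsFP R n (M × P) := by
  induction n generalizing M P with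
  | zero =>
    have : Module.Finite R M := h
    exact (inferInstance : Module.Finite R (M × P))
  | succ n ih =>
    obtain ⟨m, f, hf, h⟩ := h
    obtain ⟨l, g, hg⟩ := Module.Finite.exists_fin' R P
    obtain ⟨h1, h2⟩ := finite_projective_ker g hg
    let e : (Fin (m + l) → R) ≃ₗ[R] (Fin m → R) × (Fin l → R) :=
      (LinearEquiv.funCongrLeft R R finSumFinEquiv).trans
        (LinearEquiv.sumArrowLequivProdArrow (Fin m) (Fin l) R R)
    refine ⟨m + l, (f.prodMap g) ∘ₗ e.toLinearMap, (hf.prodMap hg).comp e.surjective, ?_⟩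
    refine (ih h (LinearMap.ker g)).of_equiv ?_
    exact LinearEquiv.ofBijective
      ((e.symm.toLinearMap ∘ₗ
        ((LinearMap.ker f).subtype.prodMap (LinearMap.ker g).subtype)).codRestrict
        (LinearMap.ker ((f.prodMap g) ∘ₗ e.toLinearMap)) fun x => by simp)
      ⟨fun x y h => by
        have h' := e.symm.injective (congrArg Subtype.val h)
        exact Prod.ext (Subtype.ext (congrArg Prod.fst h')) (Subtype.ext (congrArg Prod.snd h')),
      fun y => by
        have hy : (f.prodMap g) (e y.1) = 0 := y.2
        exact ⟨(⟨(e y.1).1, congrArg Prod.fst hy⟩, ⟨(e y.1).2, congrArg Prod.snd hy⟩),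
          Subtype.ext (e.symm_apply_apply y.1)⟩⟩

lemma IsFP.of_prod {n : ℕ} [Module.Finite R P] [Module.Projective R P]
    (h : IsFP R n (M × P)) : IsFP R n M := by
  cases n with
  | zero =>
    have : Module.Finite R (M × P) := h
    exact Module.Finite.of_surjective (LinearMap.fst R M P) Prod.fst_surjective
  | succ n =>
    obtain ⟨m, f, hf, h⟩ := h
    refine ⟨m, LinearMap.fst R M P ∘ₗ f, Prod.fst_surjective.comp hf, ?_⟩
    -- `ker f` is contained in `ker (fst ∘ f)`, with quotient `P`.
    let q : LinearMap.ker (LinearMap.fst R M P ∘ₗ f) →ₗ[R] P :=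
      LinearMap.snd R M P ∘ₗ f ∘ₗ (LinearMap.ker (LinearMap.fst R M P ∘ₗ f)).subtype
    have hq : Function.Surjective q := fun p => by
      obtain ⟨x, hx⟩ := hf (0, p)
      exact ⟨⟨x, congrArg Prod.fst hx⟩, congrArg Prod.snd hx⟩
    let e : LinearMap.ker f ≃ₗ[R] LinearMap.ker q := LinearEquiv.ofBijective
      (((LinearMap.ker f).subtype.codRestrict (LinearMap.ker (LinearMap.fst R M P ∘ₗ f))
        fun x => by simp).codRestrict (LinearMap.ker q) fun x => congrArg Prod.snd x.2)
      ⟨fun x y h => Subtype.ext (congrArg (fun z => z.1.1) h), fun y =>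
        ⟨⟨y.1.1, Prod.ext y.1.2 y.2⟩, rfl⟩⟩
    have h' := (IsFP.of_equiv (N := LinearMap.ker q) h e).prod P
    exact h'.of_equiv (N := LinearMap.ker (LinearMap.fst R M P ∘ₗ f)) (kerProdEquiv q hq)

/-- The first syzygy of a module of type `FPₙ₊₁` is of type `FPₙ`, for any choice of a finitely
generated projective module that covers it. -/
lemma IsFP.ker {n : ℕ} (h : IsFP R (n + 1) M) [Module.Finite R P] [Module.Projective R P]
    (g : P →ₗ[R] M) (hg : Function.Surjective g) : IsFP R n (LinearMap.ker g) := by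
  obtain ⟨m, f, hf, h⟩ := h
  obtain ⟨e⟩ := exists_schanuel f hf g hg
  exact ((h.prod P).of_equiv e).of_prod

lemma IsFP.of_ker {n : ℕ} [Module.Finite R P] [Module.Projective R P]
    (g : P →ₗ[R] M) (hg : Function.Surjective g) (h : IsFP R n (LinearMap.ker g)) :
    IsFP R (n + 1) M := by
  have : Module.Finite R M := Module.Finite.of_surjective g hg
  obtain ⟨m, f, hf⟩ := Module.Finite.exists_fin' R M
  obtain ⟨e⟩ := exists_schanuel g hg f hf
  exact ⟨m, f, hf, ((h.prod (Fin m → R)).of_equiv e).of_prod⟩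

/-- Splicing of presentations, in the middle of a resolution. -/
lemma IsFP.of_exact {n : ℕ} [Module.Finite R P] [Module.Projective R P]
    (f : P →ₗ[R] M) (g : M →ₗ[R] N) (hfg : Function.Exact f g) (h : IsFP R n (LinearMap.ker f)) :
    IsFP R (n + 1) (LinearMap.ker g) := by
  refine IsFP.of_ker
    (f.codRestrict (LinearMap.ker g) fun x => LinearMap.mem_ker.2 ((hfg _).2 ⟨x, rfl⟩)) ?_ ?_
  · rintro ⟨y, hy⟩
    obtain ⟨x, hx⟩ := (hfg y).1 hy
    exact ⟨x, Subtype.ext hx⟩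
  · rwa [LinearMap.ker_codRestrict]

lemma finite_ker_of_exact [Module.Finite R P]
    (f : P →ₗ[R] M) (g : M →ₗ[R] N) (hfg : Function.Exact f g) :
    Module.Finite R (LinearMap.ker g) := by
  refine Module.Finite.of_surjective
    (f.codRestrict (LinearMap.ker g) fun x => (hfg _).2 ⟨x, rfl⟩) ?_
  rintro ⟨y, hy⟩
  obtain ⟨x, hx⟩ := (hfg y).1 hy
  exact ⟨x, Subtype.ext hx⟩

lemma IsFP.of_hasFGProjectiveResolution {M : ModuleCat.{u} R}
    (h : HasFGProjectiveResolution M) (n : ℕ) : IsFP R n M := by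
  obtain ⟨P, hP⟩ := h
  have hproj : ∀ j, Module.Projective R (P.complex.X j) := fun j =>
    (IsProjective.iff_projective _).2 (P.projective j)
  have hex : ∀ j, Function.Exact (P.complex.d (j + 2) (j + 1)).hom (P.complex.d (j + 1) j).hom :=
    fun j => (ShortComplex.ShortExact.moduleCat_exact_iff_function_exact _).1 (P.exact_succ j)
  -- Each kernel is covered by the next term of the resolution.
  have hker : ∀ n j, IsFP R n (LinearMap.ker (P.complex.d (j + 1) j).hom) := by
    intro n
    induction n with
    | zero => exact fun j => finite_ker_of_exact _ _ (hex j)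
    | succ n ih => exact fun j => IsFP.of_exact _ _ (hex j) (ih (j + 1))
  have hex₀ : Function.Exact (P.complex.d 1 0).hom (P.π.f 0).hom :=
    (ShortComplex.ShortExact.moduleCat_exact_iff_function_exact _).1 P.exact₀
  have hsurj : Function.Surjective (P.π.f 0).hom :=
    (ModuleCat.epi_iff_surjective _).1 inferInstance
  have e : ((ChainComplex.single₀ (ModuleCat.{u} R)).obj M).X 0 ≃ₗ[R] M :=
    (HomologicalComplex.singleObjXSelf (ComplexShape.down ℕ) 0 M).toLinearEquiv
  refine IsFP.of_equiv ?_ e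
  cases n with
  | zero => exact Module.Finite.of_surjective _ hsurj
  | succ n =>
    refine IsFP.of_ker _ hsurj ?_
    cases n with
    | zero => exact finite_ker_of_exact _ _ hex₀
    | succ n => exact IsFP.of_exact _ _ hex₀ (hker n 0)
end FP

/-! ### The functor `N ↦ N ⊗ W` -/

section Twist

open scoped ModuleCat

variable {k R A W : Type u} [Field k] [Ring R] [Algebra k R] [Ring A] [Algebra k A]
  [AddCommGroup W] [Module k W]

section OfRep

variable {V V' : Type u} [AddCommGroup V] [Module k V] [AddCommGroup V'] [Module k V']

lemma rep_algebraMap_apply (ρ : A →ₐ[k] Module.End k V) (c : k) (x : V) :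
    ρ (algebraMap k A c) x = c • x := by
  rw [AlgHom.commutes, Module.algebraMap_end_apply]

/-- A linear map intertwining two representations, as a morphism of modules. -/
def ofRepHom (ρ : A →ₐ[k] Module.End k V) (ρ' : A →ₐ[k] Module.End k V') (f : V →ₗ[k] V')
    (hf : ∀ a x, f (ρ a x) = ρ' a (f x)) : ofRep ρ ⟶ ofRep ρ' :=
  ModuleCat.ofHom (X := ofRep ρ) (Y := ofRep ρ')
    { toFun := f
      map_add' := f.map_add
      map_smul' := hf }

/-- A linear isomorphism intertwining two representations, as an isomorphism of modules. -/
def ofRepIso (ρ : A →ₐ[k] Module.End k V) (ρ' : A →ₐ[k] Module.End k V') (f : V ≃ₗ[k] V')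
    (hf : ∀ a x, f (ρ a x) = ρ' a (f x)) : ofRep ρ ≅ ofRep ρ' where
  hom := ofRepHom ρ ρ' f hf
  inv := ofRepHom ρ' ρ f.symm fun a x => f.injective <| by simp [hf]
  hom_inv_id := by ext x; exact f.symm_apply_apply x
  inv_hom_id := by ext x; exact f.apply_symm_apply x

end OfRep

variable (γ : A →ₐ[k] R ⊗[k] Module.End k W)

/-- The action of `A` on `Z ⊗ W`, for a representation `Z` of `R`, through an algebra homomorphism
`A → R ⊗ End W`. -/
def tensorRep {Z : Type u} [AddCommGroup Z] [Module k Z] (σ : R →ₐ[k] Module.End k Z) :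
    A →ₐ[k] Module.End k (Z ⊗[k] W) :=
  (Module.endTensorEndAlgHom (R := k) (S := k) (A := k) (M := Z) (N := W)).comp
    ((Algebra.TensorProduct.map σ (AlgHom.id k (Module.End k W))).comp γ)

lemma tensorRep_tmul {Z : Type u} [AddCommGroup Z] [Module k Z] (σ : R →ₐ[k] Module.End k Z)
    {a : A} {ι : Type*} {s : Finset ι} {r : ι → R} {e : ι → Module.End k W}
    (ha : γ a = ∑ i ∈ s, r i ⊗ₜ[k] e i) (z : Z) (w : W) :
    tensorRep γ σ a (z ⊗ₜ[k] w) = ∑ i ∈ s, σ (r i) z ⊗ₜ[k] e i w := by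
  simp [tensorRep, ha, Module.endTensorEndAlgHom_apply]

/-- The action of `A` on `Z ⊗ W` is natural in the `R`-module `Z`. -/
lemma rTensor_tensorRep {Z Z' : Type u} [AddCommGroup Z] [Module k Z] [AddCommGroup Z']
    [Module k Z'] (σ : R →ₐ[k] Module.End k Z) (σ' : R →ₐ[k] Module.End k Z') (f : Z →ₗ[k] Z')
    (hf : ∀ r z, f (σ r z) = σ' r (f z)) (a : A) (x : Z ⊗[k] W) :
    f.rTensor W (tensorRep γ σ a x) = tensorRep γ σ' a (f.rTensor W x) := by
  suffices h : ∀ t : R ⊗[k] Module.End k W,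
      f.rTensor W (Module.endTensorEndAlgHom (R := k) (S := k) (A := k)
        (Algebra.TensorProduct.map σ (AlgHom.id k (Module.End k W)) t) x) =
      Module.endTensorEndAlgHom (R := k) (S := k) (A := k)
        (Algebra.TensorProduct.map σ' (AlgHom.id k (Module.End k W)) t) (f.rTensor W x) from
    h (γ a)
  intro t
  induction t with
  | zero => simp
  | add s t hs ht => simp only [map_add, LinearMap.add_apply, hs, ht]
  | tmul r e =>
    induction x with
    | zero => simp
    | add x y hx hy => simp only [map_add, hx, hy]
    | tmul n w => simp [Module.endTensorEndAlgHom_apply, hf]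

/-- The functor `N ↦ N ⊗ W` from `R`-modules to `A`-modules given by an algebra homomorphism
`A → R ⊗ End W`. -/
def tensorFunctor : ModuleCat.{u} R ⥤ ModuleCat.{u} A where
  obj N := ofRep (tensorRep γ (Algebra.lsmul k k N))
  map {N N'} f := ofRepHom _ _ ((f.hom.restrictScalars k).rTensor W)
    (rTensor_tensorRep γ _ _ _ f.hom.map_smul)
  map_id N := by
    ext x
    exact LinearMap.congr_fun (LinearMap.rTensor_id W N) x
  map_comp {N N' N''} f g := by
    ext x
    exact LinearMap.congr_fun
      (LinearMap.rTensor_comp W (g.hom.restrictScalars k) (f.hom.restrictScalars k)) x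

/-- The element `n ⊗ w` of the `A`-module `N ⊗ W`. -/
def tensorElt (N : ModuleCat.{u} R) (n : N) (w : W) : (tensorFunctor γ).obj N :=
  (n ⊗ₜ[k] w : N ⊗[k] W)

instance : (tensorFunctor γ).Additive where
  map_add {N N' f g} := by
    ext x
    exact LinearMap.congr_fun
      (LinearMap.rTensor_add W (f.hom.restrictScalars k) (g.hom.restrictScalars k)) x

instance : (tensorFunctor γ).Linear k where
  map_smul {N N'} f c := by
    ext x
    refine (LinearMap.congr_fun
      (LinearMap.rTensor_smul W c (f.hom.restrictScalars k)) x).trans ?_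
    exact (rep_algebraMap_apply (tensorRep γ (Algebra.lsmul k k N')) c
      ((f.hom.restrictScalars k).rTensor W x)).symm

lemma tensorFunctor_exact {N₁ N₂ N₃ : ModuleCat.{u} R} (f : N₁ ⟶ N₂) (g : N₂ ⟶ N₃)
    (h : Function.Exact f.hom g.hom) :
    Function.Exact ((tensorFunctor γ).map f).hom ((tensorFunctor γ).map g).hom :=
  Module.Flat.rTensor_exact W (f := f.hom.restrictScalars k) (g := g.hom.restrictScalars k) h

lemma tensorFunctor_preserves :
    Limits.PreservesFiniteLimits (tensorFunctor γ) ∧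
      Limits.PreservesFiniteColimits (tensorFunctor γ) := by
  refine ((Functor.exact_tfae (tensorFunctor γ)).out 1 3).1 fun S hS => ?_
  rw [ShortComplex.ShortExact.moduleCat_exact_iff_function_exact] at hS ⊢
  exact tensorFunctor_exact γ S.f S.g hS

instance : Limits.PreservesFiniteLimits (tensorFunctor γ) := (tensorFunctor_preserves γ).1

instance : Limits.PreservesFiniteColimits (tensorFunctor γ) := (tensorFunctor_preserves γ).2

/-- The value of `tensorFunctor` on a module given by a representation. -/
def tensorFunctorIso {Z : Type u} [AddCommGroup Z] [Module k Z] (σ : R →ₐ[k] Module.End k Z)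
    (N : ModuleCat.{u} R) (ι : N ≃ₗ[k] Z) (hι : ∀ (r : R) (n : N), ι (r • n) = σ r (ι n)) :
    (tensorFunctor γ).obj N ≅ ofRep (tensorRep γ σ) :=
  ofRepIso _ _ (ι.rTensor W) (rTensor_tensorRep γ (Algebra.lsmul k k N) σ ι.toLinearMap hι)

/-- The vector space underlying the module of a representation. -/
def ofRepEquiv {V : Type u} [AddCommGroup V] [Module k V] (ρ : A →ₐ[k] Module.End k V) :
    ofRep ρ ≃ₗ[k] V where
  toFun x := x
  invFun x := x
  left_inv _ := rfl
  right_inv _ := rfl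
  map_add' _ _ := rfl
  map_smul' c x := rep_algebraMap_apply ρ c x

/-- An `R`-linear isomorphism, as a linear isomorphism of the underlying vector spaces. For
`N = ModuleCat.of R Z`, the vector space structure of `N` comes from restriction of scalars and
need not be definitionally the one of `Z`. -/
def restrictEquiv (k : Type u) [Field k] [Algebra k R] (N : ModuleCat.{u} R) {Z : Type u}
    [AddCommGroup Z] [Module R Z] [Module k Z] [IsScalarTower k R Z] (e : N ≃ₗ[R] Z) : N ≃ₗ[k] Z :=
  e.restrictScalars k

/-- The value of `tensorFunctor` on a module whose type carries a vector space structure. -/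
def tensorFunctorOfIso (Z : Type u) [AddCommGroup Z] [Module R Z] [Module k Z]
    [IsScalarTower k R Z] :
    (tensorFunctor γ).obj (ModuleCat.of R Z) ≅ ofRep (tensorRep γ (Algebra.lsmul k k Z)) :=
  tensorFunctorIso γ _ _ (restrictEquiv k (ModuleCat.of R Z) (LinearEquiv.refl R Z))
    fun _ _ => rfl

end Twist

/-! ### Comparison of `Ext` groups along an exact functor -/

section Comparison

universe w w' v₁ v₂ u₁ u₂

variable {k : Type u} [Field k] {C : Type u₁} [Category.{v₁} C] [Abelian C] [Linear k C]
  [HasExt.{w} C] {D : Type u₂} [Category.{v₂} D] [Abelian D] [Linear k D] [HasExt.{w'} D]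
  (F : C ⥤ D) [F.Additive] [F.Linear k] [Limits.PreservesFiniteLimits F]
  [Limits.PreservesFiniteColimits F]
  {Z : C} {Y : D} {V : Type u} [AddCommGroup V] [Module k V] (θ : V →ₗ[k] Ext (F.obj Z) Y 0)

/-- The linear map `Ext^n(N, Z) ⊗ V → Ext^n(F N, Y)`, `e ⊗ v ↦ θ(v) ∘ F(e)`. -/
def extCompare (N : C) (n : ℕ) : Ext N Z n ⊗[k] V →ₗ[k] Ext (F.obj N) Y n :=
  TensorProduct.lift <| LinearMap.compl₁₂ (Ext.bilinearCompOfLinear k (F.obj N) (F.obj Z) Y n 0 n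
    (add_zero n)) (F.mapExtLinearMap k N Z n) θ

lemma extCompare_tmul (N : C) (n : ℕ) (e : Ext N Z n) (v : V) :
    extCompare F θ N n (e ⊗ₜ v) = (e.mapExactFunctor F).comp (θ v) (add_zero n) := by
  simp [extCompare, Functor.mapExtLinearMap_apply]

lemma extCompare_precomp {N N' : C} {a n m : ℕ} (α : Ext N' N a) (h : a + n = m)
    (t : Ext N Z n ⊗[k] V) :
    extCompare F θ N' m ((α.precompOfLinear k Z h).rTensor V t) =
      (α.mapExactFunctor F).comp (extCompare F θ N n t) h := by
  induction t with
  | zero => simp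
  | add s t hs ht => simp only [map_add, hs, ht, Ext.comp_add]
  | tmul e v =>
    rw [LinearMap.rTensor_tmul, extCompare_tmul, extCompare_tmul,
      Ext.bilinearCompOfLinear_apply_apply, Ext.mapExactFunctor_comp]
    exact Ext.comp_assoc_of_third_deg_zero _ _ _ _

lemma extCompare_precomp_mk₀ {N N' : C} {n : ℕ} (f : N' ⟶ N) (t : Ext N Z n ⊗[k] V) :
    extCompare F θ N' n (((Ext.mk₀ f).precompOfLinear k Z (zero_add n)).rTensor V t) =
      (Ext.mk₀ (F.map f)).comp (extCompare F θ N n t) (zero_add n) := by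
  rw [extCompare_precomp, Ext.mapExactFunctor_mk₀]

/-- If composing `θ(v)` with `f : Y → Y'` gives a sum of elements `θ'(uᵢ) ∘ F(gᵢ)`, then `f` acts on
the image of the comparison map through the `gᵢ` and the `uᵢ`. -/
lemma extCompare_comp {N : C} {n : ℕ} (e : Ext N Z n) (v : V) {Y' : D} (f : Ext Y Y' 0)
    {θ' : V →ₗ[k] Ext (F.obj Z) Y' 0} {ι : Type*} (s : Finset ι) (g : ι → (Z ⟶ Z)) (u : ι → V)
    (h : (θ v).comp f (add_zero 0) =
      ∑ i ∈ s, (Ext.mk₀ (F.map (g i))).comp (θ' (u i)) (zero_add 0)) :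
    (extCompare F θ N n (e ⊗ₜ v)).comp f (add_zero n) =
      ∑ i ∈ s, extCompare F θ' N n (e.comp (Ext.mk₀ (g i)) (add_zero n) ⊗ₜ u i) := by
  rw [extCompare_tmul, Ext.comp_assoc_of_second_deg_zero, h, ← Finset.sum_coe_sort s,
    ← Finset.sum_coe_sort s, Ext.comp_sum]
  refine Finset.sum_congr rfl fun i _ => ?_
  rw [extCompare_tmul, Ext.mapExactFunctor_comp, Ext.mapExactFunctor_mk₀,
    Ext.comp_assoc_of_second_deg_zero]

lemma extCompare_zero_injective_of_epi {N N' : C} (g : N ⟶ N') [Epi g]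
    (h : Function.Injective (extCompare F θ N 0)) :
    Function.Injective (extCompare F θ N' 0) := by
  have hg : Function.Injective (((Ext.mk₀ g).precompOfLinear k Z (zero_add 0)).rTensor V) :=
    Module.Flat.rTensor_preserves_injective_linearMap _ (Ext.precomp_mk₀_injective_of_epi Z g)
  refine fun s t hst => hg (h ?_)
  rw [extCompare_precomp_mk₀, extCompare_precomp_mk₀, hst]

/-- A diagram chase in the exact sequences of `Hom` groups. -/
lemma extCompare_zero_surjective {S : ShortComplex C} (hS : S.ShortExact)
    (h₂ : Function.Surjective (extCompare F θ S.X₂ 0))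
    (h₁ : Function.Injective (extCompare F θ S.X₁ 0)) :
    Function.Surjective (extCompare F θ S.X₃ 0) := by
  have := hS.epi_g
  intro y
  obtain ⟨t, ht⟩ := h₂ ((Ext.mk₀ (F.map S.g)).comp y (zero_add 0))
  have hex : Function.Exact ((Ext.mk₀ S.g).precompOfLinear k Z (zero_add 0))
      ((Ext.mk₀ S.f).precompOfLinear k Z (zero_add 0)) := by
    intro x
    refine ⟨fun hx => Ext.contravariant_sequence_exact₂ hS Z x hx, ?_⟩
    rintro ⟨x, rfl⟩
    simp
  have ht' : ((Ext.mk₀ S.f).precompOfLinear k Z (zero_add 0)).rTensor V t = 0 := by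
    refine h₁ ?_
    rw [extCompare_precomp_mk₀, ht, map_zero, Ext.mk₀_comp_mk₀_assoc, ← F.map_comp, S.zero,
      F.map_zero, Ext.mk₀_zero, Ext.zero_comp]
  obtain ⟨s, rfl⟩ := (Module.Flat.rTensor_exact V hex t).1 ht'
  refine ⟨s, Ext.precomp_mk₀_injective_of_epi Y (F.map S.g) ?_⟩
  rw [extCompare_precomp_mk₀] at ht
  exact ht

/-- Dimension shifting: `Ext^{n+1}(X₃, -)` is the cokernel of `Ext^n(X₂, -) → Ext^n(X₁, -)`. -/
lemma extCompare_succ_bijective {S : ShortComplex C} (hS : S.ShortExact) (n : ℕ)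
    [Projective S.X₂] [Projective (F.obj S.X₂)]
    (h₂ : Function.Surjective (extCompare F θ S.X₂ n))
    (h₁ : Function.Bijective (extCompare F θ S.X₁ n)) :
    Function.Bijective (extCompare F θ S.X₃ (n + 1)) := by
  have hFS := hS.map_of_exact F
  have : Projective (S.map F).X₂ := ‹Projective (F.obj S.X₂)›
  have hδ : ∀ t, extCompare F θ S.X₃ (n + 1)
      ((hS.extClass.precompOfLinear k Z (add_comm 1 n)).rTensor V t) =
        hFS.extClass.comp (extCompare F θ S.X₁ n t) (add_comm 1 n) := fun t => by
    rw [extCompare_precomp, Ext.mapExactFunctor_extClass]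
    rfl
  constructor
  · rw [← LinearMap.ker_eq_bot, LinearMap.ker_eq_bot']
    intro t ht
    obtain ⟨t, rfl⟩ := LinearMap.rTensor_surjective V
      (g := hS.extClass.precompOfLinear k Z (add_comm 1 n))
      (fun x => Ext.contravariant_sequence_exact₃ hS Z x (Ext.eq_zero_of_projective _)
        (add_comm 1 n)) t
    rw [hδ] at ht
    obtain ⟨y, hy⟩ := Ext.contravariant_sequence_exact₁ hFS Y _ _ ht
    obtain ⟨s, rfl⟩ := h₂ y
    have hs : ((Ext.mk₀ S.f).precompOfLinear k Z (zero_add n)).rTensor V s = t :=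
      h₁.1 ((extCompare_precomp_mk₀ F θ S.f s).trans hy)
    rw [← hs, ← LinearMap.comp_apply, ← LinearMap.rTensor_comp]
    have h0 : hS.extClass.precompOfLinear k Z (add_comm 1 n) ∘ₗ
        (Ext.mk₀ S.f).precompOfLinear k Z (zero_add n) = 0 := by
      ext x
      simp
    rw [h0, LinearMap.rTensor_zero, LinearMap.zero_apply]
  · intro y
    obtain ⟨y, rfl⟩ := Ext.contravariant_sequence_exact₃ hFS Y y (Ext.eq_zero_of_projective _)
      (add_comm 1 n)
    obtain ⟨t, rfl⟩ := h₁.2 y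
    exact ⟨_, hδ t⟩

/-- The comparison map is compatible with finite direct sums. It is enough that the identity of `P`
factors through finitely many copies of `N`. -/
lemma extCompare_bijective_of_sum {ι : Type*} [Fintype ι] {N P : C} {n : ℕ} (p : ι → (P ⟶ N))
    (s : ι → (N ⟶ P)) (hps : ∑ i, p i ≫ s i = 𝟙 P)
    (h : Function.Bijective (extCompare F θ N n)) : Function.Bijective (extCompare F θ P n) := by
  constructor
  · rw [← LinearMap.ker_eq_bot, LinearMap.ker_eq_bot']
    intro t ht
    have h1 : ∀ i, ((Ext.mk₀ (s i)).precompOfLinear k Z (zero_add n)).rTensor V t = 0 := fun i =>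
      h.1 (by rw [extCompare_precomp_mk₀, ht, Ext.comp_zero, map_zero])
    have h2 : ∑ i, (Ext.mk₀ (p i)).precompOfLinear k Z (zero_add n) ∘ₗ
        (Ext.mk₀ (s i)).precompOfLinear k Z (zero_add n) = LinearMap.id := by
      ext x
      simp [← Ext.sum_comp, ← Ext.mk₀_sum, hps]
    have h3 := LinearMap.congr_fun (congrArg (LinearMap.rTensorHom V) h2) t
    rw [map_sum, LinearMap.sum_apply] at h3
    refine Eq.trans ?_ (h3.symm.trans ?_)
    · exact (LinearMap.rTensor_id_apply V _ t).symm
    · refine Finset.sum_eq_zero fun i _ => ?_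
      rw [LinearMap.coe_rTensorHom, LinearMap.rTensor_comp, LinearMap.comp_apply, h1, map_zero]
  · intro y
    choose t ht using fun i => h.2 ((Ext.mk₀ (F.map (s i))).comp y (zero_add n))
    refine ⟨∑ i, ((Ext.mk₀ (p i)).precompOfLinear k Z (zero_add n)).rTensor V (t i), ?_⟩
    simp only [map_sum, extCompare_precomp_mk₀, ht]
    simp only [Ext.mk₀_comp_mk₀_assoc, ← F.map_comp]
    rw [← Ext.sum_comp, ← Ext.mk₀_sum, ← F.map_sum, hps, F.map_id, Ext.mk₀_id_comp]

end Comparison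

/-! ### Exact functors between module categories -/

section ExactFunctor

variable {R A : Type u} [Ring R] [Ring A] (F : ModuleCat.{u} R ⥤ ModuleCat.{u} A) [F.Additive]

lemma sum_proj_single (R : Type u) [Ring R] (m : ℕ) :
    ∑ i, ModuleCat.ofHom (LinearMap.proj (R := R) (φ := fun _ : Fin m => R) i) ≫
      ModuleCat.ofHom (LinearMap.single R (fun _ : Fin m => R) i) =
      𝟙 (ModuleCat.of R (Fin m → R)) := by
  ext x
  simp [ModuleCat.hom_sum]

lemma finite_projective_map_pi (m : ℕ) [Module.Finite A (F.obj (ModuleCat.of R R))]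
    [Module.Projective A (F.obj (ModuleCat.of R R))] :
    Module.Finite A (F.obj (ModuleCat.of R (Fin m → R))) ∧
      Module.Projective A (F.obj (ModuleCat.of R (Fin m → R))) := by
  let s : (Fin m → F.obj (ModuleCat.of R R)) →ₗ[A] F.obj (ModuleCat.of R (Fin m → R)) :=
    LinearMap.lsum A _ ℕ fun i =>
      (F.map (ModuleCat.ofHom (LinearMap.single R (fun _ : Fin m => R) i))).hom
  let p : F.obj (ModuleCat.of R (Fin m → R)) →ₗ[A] (Fin m → F.obj (ModuleCat.of R R)) :=
    LinearMap.pi fun i =>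
      (F.map (ModuleCat.ofHom (LinearMap.proj (R := R) (φ := fun _ : Fin m => R) i))).hom
  have h : s ∘ₗ p = LinearMap.id := by
    have := congrArg (fun f => (F.map f).hom) (sum_proj_single R m)
    ext x
    have := LinearMap.congr_fun this x
    simpa [s, p, F.map_sum, ModuleCat.hom_sum] using this
  have : Module.Projective A (Fin m → F.obj (ModuleCat.of R R)) :=
    Module.Projective.of_equiv' (DFinsupp.linearEquivFunOnFintype (R := A))
  exact ⟨Module.Finite.of_surjective s fun x => ⟨p x, LinearMap.congr_fun h x⟩,
    Module.Projective.of_split p s h⟩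

variable [Limits.PreservesFiniteLimits F] [Limits.PreservesFiniteColimits F]
  {P N : ModuleCat.{u} R}

lemma map_surjective (f : P →ₗ[R] N) (hf : Function.Surjective f) :
    Function.Surjective (F.map (ModuleCat.ofHom f)).hom := by
  have : Epi (ModuleCat.ofHom f) := (ModuleCat.epi_iff_surjective _).2 hf
  exact (ModuleCat.epi_iff_surjective _).1 inferInstance

/-- An exact functor commutes with the formation of kernels. -/
lemma exists_mapKer (f : P →ₗ[R] N) (hf : Function.Surjective f) :
    Nonempty (F.obj (ModuleCat.of R (LinearMap.ker f)) ≃ₗ[A]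
      LinearMap.ker (F.map (ModuleCat.ofHom f)).hom) := by
  have hS := (LinearMap.shortExact_shortComplexKer hf).map_of_exact F
  have hmono := (ModuleCat.mono_iff_injective _).1 hS.mono_f
  have hex := (ShortComplex.ShortExact.moduleCat_exact_iff_function_exact _).1 hS.exact
  exact ⟨LinearEquiv.ofBijective
    ((F.map (ModuleCat.ofHom (LinearMap.ker f).subtype)).hom.codRestrict
      (LinearMap.ker (F.map (ModuleCat.ofHom f)).hom) fun x => (hex _).2 ⟨x, rfl⟩)
    ⟨fun x y h => hmono (congrArg Subtype.val h), fun y => by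
      obtain ⟨x, hx⟩ := (hex _).1 y.2
      exact ⟨x, Subtype.ext hx⟩⟩⟩

variable [Module.Finite A (F.obj (ModuleCat.of R R))]
    [Module.Projective A (F.obj (ModuleCat.of R R))]

/-- An exact functor that takes `R` to a finitely generated projective module preserves modules of
type `FPₙ`. -/
lemma IsFP.map {n : ℕ} {N : ModuleCat.{u} R} (h : IsFP R n N) : IsFP A n (F.obj N) := by
  induction n generalizing N with
  | zero =>
    have : Module.Finite R N := h
    obtain ⟨m, f, hf⟩ := Module.Finite.exists_fin' R N
    have := (finite_projective_map_pi F m).1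
    exact Module.Finite.of_surjective _
      (map_surjective F (P := ModuleCat.of R (Fin m → R)) f hf)
  | succ n ih =>
    obtain ⟨m, f, hf, h⟩ := h
    obtain ⟨h1, h2⟩ := finite_projective_map_pi F m
    obtain ⟨e⟩ := exists_mapKer F (P := ModuleCat.of R (Fin m → R)) f hf
    exact IsFP.of_ker _ (map_surjective F (P := ModuleCat.of R (Fin m → R)) f hf)
      ((ih (N := ModuleCat.of R (LinearMap.ker f)) h).of_equiv e)

/-- If such a functor reflects finite generation, it reflects modules of type `FPₙ`. -/
lemma IsFP.of_map (hfin : ∀ N : ModuleCat.{u} R, Module.Finite A (F.obj N) → Module.Finite R N)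
    {n : ℕ} {N : ModuleCat.{u} R} (h : IsFP A n (F.obj N)) : IsFP R n N := by
  induction n generalizing N with
  | zero => exact hfin N h
  | succ n ih =>
    have : Module.Finite R N := hfin N h.finite
    obtain ⟨m, f, hf⟩ := Module.Finite.exists_fin' R N
    obtain ⟨h1, h2⟩ := finite_projective_map_pi F m
    obtain ⟨e⟩ := exists_mapKer F (P := ModuleCat.of R (Fin m → R)) f hf
    refine ⟨m, f, hf, ih (N := ModuleCat.of R (LinearMap.ker f)) ?_⟩
    exact (h.ker _ (map_surjective F (P := ModuleCat.of R (Fin m → R)) f hf)).of_equiv e.symm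

section Linear

variable {k : Type u} [Field k] [Algebra k R] [Algebra k A] [F.Linear k]
  {Z : ModuleCat.{u} R} {Y : ModuleCat.{u} A} {V : Type u} [AddCommGroup V] [Module k V]
  (θ : V →ₗ[k] Ext (F.obj Z) Y 0)

lemma extCompare_pi_bijective (hθ : Function.Bijective (extCompare F θ (ModuleCat.of R R) 0))
    (m n : ℕ) : Function.Bijective (extCompare F θ (ModuleCat.of R (Fin m → R)) n) := by
  cases n with
  | zero => exact extCompare_bijective_of_sum F θ _ _ (sum_proj_single R m) hθ
  | succ n =>
    have h1 : Projective (ModuleCat.of R (Fin m → R)) :=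
      (IsProjective.iff_projective _).1 inferInstance
    have h2 : Projective (F.obj (ModuleCat.of R (Fin m → R))) :=
      (IsProjective.iff_projective _).1 (finite_projective_map_pi F m).2
    have h3 : Subsingleton (Ext (ModuleCat.of R (Fin m → R)) Z (n + 1)) :=
      ⟨fun a b => (Ext.eq_zero_of_projective a).trans (Ext.eq_zero_of_projective b).symm⟩
    exact ⟨fun a b _ => Subsingleton.elim a b, fun b =>
      ⟨0, (map_zero _).trans (Ext.eq_zero_of_projective b).symm⟩⟩

/-- The comparison map is an isomorphism on modules of type `FP_∞`, as soon as it is one on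
`Hom(R, Z)`. In degree `0` it is injective on all finitely generated modules, hence on the first
syzygy, which gives surjectivity; the higher degrees follow by dimension shifting. -/
theorem extCompare_bijective (hθ : Function.Bijective (extCompare F θ (ModuleCat.of R R) 0))
    (N : Type u) [AddCommGroup N] [Module R N] (hN : ∀ m, IsFP R m N) (n : ℕ) :
    Function.Bijective (extCompare F θ (ModuleCat.of R N) n) := by
  induction n generalizing N with
  | zero =>
    have hinj : ∀ (M : Type u) [AddCommGroup M] [Module R M], Module.Finite R M →
        Function.Injective (extCompare F θ (ModuleCat.of R M) 0) := fun M _ _ _ => by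
      obtain ⟨m, f, hf⟩ := Module.Finite.exists_fin' R M
      have : Epi (ModuleCat.ofHom f) := (ModuleCat.epi_iff_surjective _).2 hf
      exact extCompare_zero_injective_of_epi F θ (ModuleCat.ofHom f)
        (extCompare_pi_bijective F θ hθ m 0).1
    obtain ⟨m, f, hf, h⟩ := hN 1
    have hS := LinearMap.shortExact_shortComplexKer hf
    have h3 : Function.Surjective (extCompare F θ f.shortComplexKer.X₂ 0) :=
      (extCompare_pi_bijective F θ hθ m 0).2
    have h4 : Function.Injective (extCompare F θ f.shortComplexKer.X₁ 0) :=
      hinj (LinearMap.ker f) h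
    have h5 := extCompare_zero_surjective F θ hS h3 h4
    exact ⟨hinj N (hN 0), h5⟩
  | succ n ih =>
    obtain ⟨m, f, hf, -⟩ := hN 1
    have hS := LinearMap.shortExact_shortComplexKer hf
    have h1 : Projective f.shortComplexKer.X₂ :=
      (IsProjective.iff_projective _).1 (inferInstance : Module.Projective R (Fin m → R))
    have h2 : Projective (F.obj f.shortComplexKer.X₂) :=
      (IsProjective.iff_projective _).1 (finite_projective_map_pi F m).2
    have h3 : Function.Surjective (extCompare F θ f.shortComplexKer.X₂ n) :=
      (extCompare_pi_bijective F θ hθ m n).2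
    have h4 : Function.Bijective (extCompare F θ f.shortComplexKer.X₁ n) :=
      ih (LinearMap.ker f) fun l => (hN (l + 1)).ker f hf
    have h5 := extCompare_succ_bijective F θ hS n h3 h4
    exact h5

end Linear

end ExactFunctor

/-! ### The comparison map on the free module of rank one -/

section Base

variable {k R A : Type u} [Field k] [Ring R] [Ring A] [Algebra k R] [Algebra k A]
  (F : ModuleCat.{u} R ⥤ ModuleCat.{u} A) [F.Additive] [F.Linear k]
  [Limits.PreservesFiniteLimits F] [Limits.PreservesFiniteColimits F]
  {Z : Type u} [AddCommGroup Z] [Module R Z] [Module k Z] [IsScalarTower k R Z]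
  {Y : ModuleCat.{u} A} {V : Type u} [AddCommGroup V] [Module k V]
  (θ : V →ₗ[k] Ext (F.obj (ModuleCat.of R Z)) Y 0)

/-- The homomorphism `R → Z` sending `1` to `z`. -/
def ofElement (R : Type u) [Ring R] {Z : Type u} [AddCommGroup Z] [Module R Z] (z : Z) :
    ModuleCat.of R R ⟶ ModuleCat.of R Z :=
  ModuleCat.ofHom (LinearMap.toSpanSingleton R Z z)

/-- `Z ≅ Ext⁰(R, Z)`. -/
def extZeroFreeEquiv (k R Z : Type u) [Field k] [Ring R] [Algebra k R] [AddCommGroup Z]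
    [Module R Z] [Module k Z] [IsScalarTower k R Z] :
    Z ≃ₗ[k] Ext (ModuleCat.of R R) (ModuleCat.of R Z) 0 where
  toFun z := Ext.mk₀ (ofElement R z)
  invFun e := (Ext.addEquiv₀ e).hom (1 : R)
  left_inv z := (congrArg (fun f : ModuleCat.of R R ⟶ ModuleCat.of R Z => f.hom (1 : R))
    (Ext.addEquiv₀.apply_symm_apply (ofElement R z))).trans (one_smul R z)
  right_inv e := (Ext.addEquiv₀.symm_apply_eq (y := e)).2 <|
    ModuleCat.hom_ext <| LinearMap.ext fun r =>
      ((Ext.addEquiv₀ e).hom.map_smul r (1 : R)).symm.trans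
        (congrArg (Ext.addEquiv₀ e).hom (mul_one r))
  map_add' x y := by
    rw [← Ext.mk₀_add]
    exact congrArg Ext.mk₀ (ModuleCat.hom_ext <| LinearMap.ext fun r => smul_add r x y)
  map_smul' c x := by
    rw [RingHom.id_apply, ← Ext.mk₀_smul]
    refine congrArg Ext.mk₀ (ModuleCat.hom_ext <| LinearMap.ext fun r => ?_)
    rw [smul_hom_apply]
    change r • c • x = algebraMap k R c • r • x
    rw [← algebraMap_smul R c x, smul_smul, smul_smul, Algebra.commutes]

/-- If `F(R)` is free on `x₀`, then evaluation at `1` and at `x₀` turns the comparison map for `R`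
into a map `μ : Z ⊗ V → Y`. -/
lemma extCompare_free_bijective (x₀ : F.obj (ModuleCat.of R R))
    (hx : Function.Bijective fun a : A => a • x₀) (μ : Z ⊗[k] V →+ Y)
    (hμ : ∀ z v, μ (z ⊗ₜ v) = (Ext.addEquiv₀ (θ v)).hom ((F.map (ofElement R z)).hom x₀))
    (hbij : Function.Bijective μ) : Function.Bijective (extCompare F θ (ModuleCat.of R R) 0) := by
  let ε : Z ⊗[k] V ≃ₗ[k] Ext (ModuleCat.of R R) (ModuleCat.of R Z) 0 ⊗[k] V :=
    (extZeroFreeEquiv k R Z).rTensor V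
  let ev : Ext (F.obj (ModuleCat.of R R)) Y 0 → Y := fun y => (Ext.addEquiv₀ y).hom x₀
  have hev : Function.Bijective ev := by
    let κ : A ≃ₗ[A] F.obj (ModuleCat.of R R) :=
      LinearEquiv.ofBijective (LinearMap.toSpanSingleton A _ x₀) hx
    have hκ : κ 1 = x₀ := one_smul A x₀
    constructor
    · intro f g hfg
      refine Ext.addEquiv₀.injective (ModuleCat.hom_ext (LinearMap.ext fun x => ?_))
      obtain ⟨a, rfl⟩ := hx.2 x
      simp only [map_smul]
      exact congrArg (a • ·) hfg
    · intro y
      refine ⟨Ext.addEquiv₀.symm (ModuleCat.ofHom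
        (LinearMap.toSpanSingleton A Y y ∘ₗ κ.symm.toLinearMap)), ?_⟩
      change (Ext.addEquiv₀ (Ext.addEquiv₀.symm (ModuleCat.ofHom
        (LinearMap.toSpanSingleton A Y y ∘ₗ κ.symm.toLinearMap)) :
          Ext (F.obj (ModuleCat.of R R)) Y 0)).hom x₀ = y
      rw [AddEquiv.apply_symm_apply, ← hκ]
      simp
  have hcomp : ∀ t, ev (extCompare F θ (ModuleCat.of R R) 0 (ε t)) = μ t := by
    intro t
    induction t with
    | zero => simp [ev]
    | add s t hs ht => rw [map_add, map_add, map_add, ← hs, ← ht]; simp [ev]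
    | tmul z v =>
      have h : ε (z ⊗ₜ v) = Ext.mk₀ (ofElement R z) ⊗ₜ v := by
        rfl
      rw [h, extCompare_tmul, Ext.mapExactFunctor_mk₀, hμ]
      obtain ⟨f, hf⟩ := (Ext.addEquiv₀.symm).surjective (θ v)
      have hf' : θ v = Ext.mk₀ f := hf.symm
      rw [← hf, AddEquiv.apply_symm_apply, hf, hf', Ext.mk₀_comp_mk₀]
      change (Ext.addEquiv₀ (Ext.addEquiv₀.symm (F.map (ofElement R z) ≫ f) :
        Ext (F.obj (ModuleCat.of R R)) Y 0)).hom x₀ = _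
      rw [AddEquiv.apply_symm_apply]
      rfl
  have h1 : ev ∘ (extCompare F θ (ModuleCat.of R R) 0) ∘ ε = μ := funext hcomp
  rw [← Function.Bijective.of_comp_iff _ ε.bijective, ← Function.Bijective.of_comp_iff' hev, h1]
  exact hbij

end Base

/-! ### The comparison map for the functor `N ↦ N ⊗ W` -/

section Core

open scoped ModuleCat

variable {k R A W : Type u} [Field k] [Ring R] [Algebra k R] [Ring A] [Algebra k A]
  [AddCommGroup W] [Module k W]

/-- The functor `N ↦ N ⊗ W` reflects finite generation: the generators of `N ⊗ W` lie in `N' ⊗ W`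
for a finitely generated submodule `N'` of `N`, and `N' ⊗ W = N ⊗ W` forces `N' = N` for `W ≠ 0`. -/
lemma finite_of_finite_tensorFunctor [Nontrivial W] (γ : A →ₐ[k] R ⊗[k] Module.End k W)
    (N : ModuleCat.{u} R) (h : Module.Finite A ((tensorFunctor γ).obj N)) : Module.Finite R N := by
  obtain ⟨s, hs⟩ : ∃ s : Finset (N ⊗[k] W), ∀ S : Submodule A ((tensorFunctor γ).obj N),
      (∀ x ∈ s, x ∈ S) → S = ⊤ := by
    obtain ⟨s, hs⟩ := h.fg_top
    exact ⟨s, fun S hS => eq_top_iff.2 (hs ▸ Submodule.span_le.2 hS)⟩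
  obtain ⟨M, hM, hsM⟩ := TensorProduct.exists_finite_submodule_left_of_setFinite (R := k) (M := N)
    (N := W) (s : Set (N ⊗[k] W)) s.finite_toSet
  obtain ⟨T, rfl⟩ := Module.Finite.iff_fg.1 hM
  let N' : Submodule R N := Submodule.span R T
  have hle : Submodule.span k (T : Set N) ≤ N'.restrictScalars k :=
    Submodule.span_le.2 Submodule.subset_span
  let f : ModuleCat.of R N' ⟶ N := ModuleCat.ofHom N'.subtype
  have hmem : ∀ y : Submodule.span k (T : Set N) ⊗[k] W,
      (LinearMap.rTensor W (Submodule.span k (T : Set N)).subtype y : N ⊗[k] W) ∈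
        LinearMap.range ((tensorFunctor γ).map f).hom := by
    intro y
    induction y with
    | zero =>
      rw [map_zero]
      exact Submodule.zero_mem (LinearMap.range ((tensorFunctor γ).map f).hom)
    | add y z hy hz =>
      rw [map_add]
      exact Submodule.add_mem (LinearMap.range ((tensorFunctor γ).map f).hom) hy hz
    | tmul m w => exact ⟨((⟨m, hle m.2⟩ : N') ⊗ₜ[k] w : ModuleCat.of R N' ⊗[k] W), rfl⟩
  have hrange : LinearMap.range ((tensorFunctor γ).map f).hom = ⊤ := by
    refine hs _ fun x hx => ?_
    obtain ⟨y, rfl⟩ := hsM hx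
    exact hmem y
  -- A linear form `ε` with `ε(w₀) = 1` retracts `N ⊗ W` onto `N` and takes `N' ⊗ W` to `N'`.
  obtain ⟨w₀, hw₀⟩ := exists_ne (0 : W)
  obtain ⟨ε, hε⟩ := LinearMap.exists_leftInverse_of_injective (LinearMap.toSpanSingleton k W w₀)
    (LinearMap.ker_toSpanSingleton k hw₀)
  have hε₀ : ε w₀ = 1 := by simpa using LinearMap.congr_fun hε 1
  have hN' : N' = ⊤ := by
    refine eq_top_iff.2 fun n _ => ?_
    obtain ⟨y, hy⟩ : ∃ y : ModuleCat.of R N' ⊗[k] W,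
        (f.hom.restrictScalars k).rTensor W y = n ⊗ₜ[k] w₀ :=
      LinearMap.range_eq_top.1 hrange (n ⊗ₜ[k] w₀ : N ⊗[k] W)
    have h1 : TensorProduct.rid k N (ε.lTensor N (n ⊗ₜ[k] w₀)) ∈ N' := by
      rw [← hy]
      generalize y = y
      induction y with
      | zero => simp
      | add y z hy hz => simpa only [map_add] using N'.add_mem hy hz
      | tmul m w =>
        exact (N'.restrictScalars k).smul_mem (ε w) (show f.hom m ∈ N' from m.2)
    simpa [hε₀] using h1
  exact ⟨⟨T, hN'⟩⟩

variable (k R A W) in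
/-- The data needed to compare `Ext_R(N, Z) ⊗ V` with `Ext_A(N ⊗ W, A)`: the `A`-module `Z ⊗ W`
is free on `z₀ ⊗ w₀`, where `Z` is a free `R`-module on `z₀`; `z ⊗ w₀ = β(z) · (z₀ ⊗ w₀)`, and
every element of `A` can be written uniquely in terms of products `β(z) φ(v)`. -/
structure ComparisonData (Z V : Type u) [AddCommGroup Z] [Module R Z] [Module k Z]
    [IsScalarTower k R Z] [AddCommGroup V] [Module k V] where
  /-- The homomorphism through which `A` acts on `N ⊗ W` for an `R`-module `N`. -/
  γ : A →ₐ[k] R ⊗[k] Module.End k W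
  /-- The generator of `Z`. -/
  z₀ : Z
  /-- The element of `W` such that `z₀ ⊗ w₀` generates `Z ⊗ W`. -/
  w₀ : W
  /-- The coordinate of `z ⊗ w₀` with respect to the generator `z₀ ⊗ w₀`. -/
  β : Z →ₗ[k] A
  /-- The images of `z₀ ⊗ w₀` under the homomorphisms `Z ⊗ W → A` indexed by `V`. -/
  φ : V →ₗ[k] A
  bijective_smul : Function.Bijective fun r : R => r • z₀
  bijective_act : Function.Bijective fun a : A =>
    tensorRep γ (Algebra.lsmul k k Z) a (z₀ ⊗ₜ[k] w₀)
  act_β (z : Z) : tensorRep γ (Algebra.lsmul k k Z) (β z) (z₀ ⊗ₜ[k] w₀) = z ⊗ₜ[k] w₀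
  bijective_mul : Function.Bijective (TensorProduct.lift ((LinearMap.mul k A).compl₁₂ β φ))

namespace ComparisonData

variable {Z V : Type u} [AddCommGroup Z] [Module R Z] [Module k Z]
    [IsScalarTower k R Z] [AddCommGroup V] [Module k V] (d : ComparisonData k R A W Z V)

/-- The isomorphism `Z ⊗ W ≅ A` sending `z₀ ⊗ w₀` to `1`. -/
def coord : (tensorFunctor d.γ).obj (ModuleCat.of R Z) ≃ₗ[A] A :=
  (tensorFunctorOfIso d.γ Z).toLinearEquiv.trans
    (LinearEquiv.ofBijective (LinearMap.toSpanSingleton A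
      (ofRep (tensorRep d.γ (Algebra.lsmul k k Z))) (d.z₀ ⊗ₜ[k] d.w₀ : Z ⊗[k] W))
      d.bijective_act).symm

lemma coord_symm_apply (a : A) : (tensorFunctorOfIso d.γ Z).toLinearEquiv (d.coord.symm a) =
    tensorRep d.γ (Algebra.lsmul k k Z) a (d.z₀ ⊗ₜ[k] d.w₀) := by
  simp only [coord, LinearEquiv.trans_symm, LinearEquiv.symm_symm, LinearEquiv.trans_apply,
    LinearEquiv.apply_symm_apply]
  rfl

lemma coord_tmul (z : Z) :
    d.coord (tensorElt d.γ (ModuleCat.of R Z) z d.w₀) = d.β z := by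
  refine ((LinearEquiv.symm_apply_eq d.coord).1 ?_).symm
  exact (tensorFunctorOfIso d.γ Z).toLinearEquiv.injective
    ((d.coord_symm_apply _).trans (d.act_β z))

/-- The homomorphism `Z ⊗ W → A` sending the generator `z₀ ⊗ w₀` to `φ(v)`. -/
def homOf (v : V) : (tensorFunctor d.γ).obj (ModuleCat.of R Z) ⟶ ModuleCat.of A A :=
  ModuleCat.ofHom (X := (tensorFunctor d.γ).obj (ModuleCat.of R Z)) (Y := A)
    { toFun x := d.coord x * d.φ v
      map_add' x y := by rw [map_add, add_mul]
      map_smul' a x := by rw [map_smul, smul_eq_mul, mul_assoc, RingHom.id_apply, smul_eq_mul] }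

lemma homOf_apply (v : V) (x : (tensorFunctor d.γ).obj (ModuleCat.of R Z)) :
    (d.homOf v).hom x = d.coord x * d.φ v := rfl

lemma coord_gen : d.coord (tensorElt d.γ (ModuleCat.of R Z) d.z₀ d.w₀) = 1 := by
  refine ((LinearEquiv.symm_apply_eq d.coord).1 ?_).symm
  exact (tensorFunctorOfIso d.γ Z).toLinearEquiv.injective ((d.coord_symm_apply _).trans
    (LinearMap.congr_fun (map_one (tensorRep d.γ (Algebra.lsmul k k Z))) _))

/-- Homomorphisms out of `Z ⊗ W` are determined by the image of the generator. -/
lemma hom_ext {Y : ModuleCat.{u} A} {f g : (tensorFunctor d.γ).obj (ModuleCat.of R Z) ⟶ Y}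
    (h : f.hom (tensorElt d.γ (ModuleCat.of R Z) d.z₀ d.w₀) =
      g.hom (tensorElt d.γ (ModuleCat.of R Z) d.z₀ d.w₀)) : f = g := by
  refine ModuleCat.hom_ext (LinearMap.ext fun x => ?_)
  obtain ⟨a, rfl⟩ := d.coord.symm.surjective x
  have ha : d.coord.symm a = a • d.coord.symm 1 := by rw [← map_smul, smul_eq_mul, mul_one]
  have h1 : d.coord.symm 1 = (tensorElt d.γ (ModuleCat.of R Z) d.z₀ d.w₀) := by
    rw [← d.coord_gen, LinearEquiv.symm_apply_apply]
  rw [ha, map_smul, map_smul, h1, h]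

/-- The homomorphisms `homOf v`, as a linear map in `v`. -/
def homs : V →ₗ[k] Ext ((tensorFunctor d.γ).obj (ModuleCat.of R Z)) (ModuleCat.of A A) 0 where
  toFun v := Ext.mk₀ (d.homOf v)
  map_add' u v := by
    rw [← Ext.mk₀_add]
    refine congrArg Ext.mk₀ (ModuleCat.hom_ext (LinearMap.ext fun x => ?_))
    exact (congrArg (d.coord x * ·) (map_add d.φ u v)).trans (mul_add _ _ _)
  map_smul' c v := by
    rw [RingHom.id_apply, ← Ext.mk₀_smul]
    refine congrArg Ext.mk₀ (ModuleCat.hom_ext (LinearMap.ext fun x => ?_))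
    rw [smul_hom_apply, homOf_apply, homOf_apply, map_smul, mul_smul_comm, Algebra.smul_def]
    rfl

/-- The comparison map `Ext_R(N, Z) ⊗ V → Ext_A(N ⊗ W, A)`. -/
def compare (N : ModuleCat.{u} R) (n : ℕ) :
    Ext N (ModuleCat.of R Z) n ⊗[k] V →ₗ[k]
      Ext ((tensorFunctor d.γ).obj N) (ModuleCat.of A A) n :=
  extCompare (tensorFunctor d.γ) d.homs N n

/-- `R ⊗ W` is a free `A`-module of rank one. -/
lemma bijective_smul_free : Function.Bijective fun a : A =>
    a • tensorElt d.γ (ModuleCat.of R R) (1 : R) d.w₀ := by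
  let e : ModuleCat.of R R ≅ ModuleCat.of R Z := LinearEquiv.toModuleIso
    (LinearEquiv.ofBijective (LinearMap.toSpanSingleton R Z d.z₀) d.bijective_smul)
  let κ := ((tensorFunctor d.γ).mapIso e).toLinearEquiv.trans d.coord
  have hκ : κ (tensorElt d.γ (ModuleCat.of R R) (1 : R) d.w₀) = 1 := by
    refine Eq.trans ?_ d.coord_gen
    exact congrArg (fun z : Z => d.coord (tensorElt d.γ (ModuleCat.of R Z) z d.w₀))
      (one_smul R d.z₀)
  refine (Function.Bijective.of_comp_iff' κ.bijective _).1 ?_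
  have h : (κ ∘ fun a : A => a • tensorElt d.γ (ModuleCat.of R R) (1 : R) d.w₀) = id := by
    funext a
    rw [Function.comp_apply, map_smul]
    exact (congrArg (a • ·) hκ).trans (mul_one a)
  rw [h]
  exact Function.bijective_id

lemma finite_projective_free :
    Module.Finite A ((tensorFunctor d.γ).obj (ModuleCat.of R R)) ∧
      Module.Projective A ((tensorFunctor d.γ).obj (ModuleCat.of R R)) := by
  let e := LinearEquiv.ofBijective (LinearMap.toSpanSingleton A
    ((tensorFunctor d.γ).obj (ModuleCat.of R R)) _) d.bijective_smul_free
  exact ⟨Module.Finite.equiv e, Module.Projective.of_equiv e⟩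

/-- For `N = R`, the comparison map is `z ⊗ v ↦ β(z) φ(v)` up to the identifications of
`extCompare_free_bijective`. -/
theorem compare_bijective (N : Type u) [AddCommGroup N] [Module R N] (hN : ∀ m, IsFP R m N)
    (n : ℕ) : Function.Bijective (d.compare (ModuleCat.of R N) n) := by
  obtain ⟨h1, h2⟩ := d.finite_projective_free
  refine extCompare_bijective _ d.homs ?_ N hN n
  refine extCompare_free_bijective (tensorFunctor d.γ) d.homs _ d.bijective_smul_free
    (TensorProduct.lift ((LinearMap.mul k A).compl₁₂ d.β d.φ)).toAddMonoidHom ?_ d.bijective_mul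
  intro z v
  refine Eq.trans ?_ (congrArg (fun f : (tensorFunctor d.γ).obj (ModuleCat.of R Z) ⟶
    ModuleCat.of A A => f.hom (((tensorFunctor d.γ).map (ofElement R z)).hom
      (tensorElt d.γ (ModuleCat.of R R) (1 : R) d.w₀)))
    (Ext.addEquiv₀.apply_symm_apply (d.homOf v))).symm
  refine Eq.trans ?_ (homOf_apply _ _ _).symm
  refine congrArg (· * d.φ v) ?_
  refine (d.coord_tmul z).symm.trans ?_
  exact congrArg (fun z : Z => d.coord (tensorElt d.γ (ModuleCat.of R Z) z d.w₀))
    (one_smul R z).symm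

/-- The action of `s` on `Ext_A(N ⊗ W, A)` by right multiplication corresponds to an action on
`Ext_R(N, Z) ⊗ V` that can be read off from `φ(v) s`. -/
lemma compare_comp {T : Type u} [Ring T] [Module T Z] [SMulCommClass R T Z] [SMulCommClass T R Z]
    {N : ModuleCat.{u} R} {n : ℕ} (e : Ext N (ModuleCat.of R Z) n) (v : V) (s : A)
    {ι : Type*} (I : Finset ι) (t : ι → T) (u : ι → V)
    (h : d.φ v * s = ∑ i ∈ I, d.β (t i • d.z₀) * d.φ (u i)) :
    (d.compare N n (e ⊗ₜ v)).comp (Ext.mk₀ (actHom A (op s))) (add_zero n) =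
      ∑ i ∈ I, d.compare N n (e.comp (Ext.mk₀ (actHom R (t i))) (add_zero n) ⊗ₜ u i) := by
  refine extCompare_comp _ _ e v _ I (fun i => actHom R (t i)) u ?_
  have h1 : d.homOf v ≫ actHom A (op s) =
      ∑ i ∈ I, (tensorFunctor d.γ).map (actHom R (t i)) ≫ d.homOf (u i) := by
    refine d.hom_ext ?_
    rw [ModuleCat.hom_sum, LinearMap.sum_apply]
    refine Eq.trans ?_ (h.trans (Finset.sum_congr rfl fun i _ => ?_))
    · change (d.coord _ * d.φ v) * s = _
      rw [coord_gen, one_mul]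
    · rw [← coord_tmul]
      rfl
  change (Ext.mk₀ (d.homOf v)).comp (Ext.mk₀ (actHom A (op s))) (add_zero 0) =
    ∑ i ∈ I, (Ext.mk₀ ((tensorFunctor d.γ).map (actHom R (t i)))).comp
      (Ext.mk₀ (d.homOf (u i))) (zero_add 0)
  rw [Ext.mk₀_comp_mk₀, h1, ← Finset.sum_coe_sort I, ← Finset.sum_coe_sort I, Ext.mk₀_sum]
  exact Finset.sum_congr rfl fun i _ => (Ext.mk₀_comp_mk₀ _ _).symm

/-- The finiteness conditions on `N` and on `N ⊗ W` agree. -/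
lemma isFP_map_iff [Nontrivial W] (N : ModuleCat.{u} R) (n : ℕ) :
    IsFP A n ((tensorFunctor d.γ).obj N) ↔ IsFP R n N := by
  obtain ⟨h1, h2⟩ := d.finite_projective_free
  exact ⟨IsFP.of_map _ (finite_of_finite_tensorFunctor d.γ), IsFP.map _⟩

end ComparisonData

end Core

/-! ### Convolution operators -/

section Convolution

open Coalgebra

variable {k C W : Type u} [Field k] [AddCommGroup C] [Module k C] [Coalgebra k C]
  [AddCommGroup W] [Module k W]

/-- The operator `x ⊗ w ↦ x₁ ⊗ f(x₂) w` on `C ⊗ W`. -/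
def comulRight (f : C →ₗ[k] Module.End k W) : C ⊗[k] W →ₗ[k] C ⊗[k] W :=
  (TensorProduct.lift f).lTensor C ∘ₗ (TensorProduct.assoc k C C W).toLinearMap ∘ₗ
    (comul (R := k) (A := C)).rTensor W

/-- The operator `x ⊗ w ↦ x₂ ⊗ f(x₁) w` on `C ⊗ W`. -/
def comulLeft (f : C →ₗ[k] Module.End k W) : C ⊗[k] W →ₗ[k] C ⊗[k] W :=
  (TensorProduct.lift f).lTensor C ∘ₗ (TensorProduct.assoc k C C W).toLinearMap ∘ₗ
    ((TensorProduct.comm k C C).toLinearMap ∘ₗ comul (R := k) (A := C)).rTensor W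

lemma comulRight_tmul (f : C →ₗ[k] Module.End k W) {x : C} {ι : Type*} (r : Repr k x ι) (w : W) :
    comulRight f (x ⊗ₜ w) = ∑ i ∈ r.index, r.left i ⊗ₜ[k] f (r.right i) w := by
  simp [comulRight, ← r.eq, TensorProduct.sum_tmul]

lemma comulLeft_tmul (f : C →ₗ[k] Module.End k W) {x : C} {ι : Type*} (r : Repr k x ι) (w : W) :
    comulLeft f (x ⊗ₜ w) = ∑ i ∈ r.index, r.right i ⊗ₜ[k] f (r.left i) w := by
  simp [comulLeft, ← r.eq, TensorProduct.sum_tmul]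

/-- `x ⊗ w ↦ x₁ ⊗ f(x₂) g(x₃) w` is the identity if `f` is a left convolution inverse of `g`. -/
lemma comulRight_comulRight {f g : C →ₗ[k] Module.End k W}
    (h : ∀ x w, ∑ i ∈ (ℛ k x).index, f ((ℛ k x).left i) (g ((ℛ k x).right i) w) =
      counit (R := k) x • w) (t : C ⊗[k] W) : comulRight f (comulRight g t) = t := by
  induction t with
  | zero => simp
  | add s t hs ht => rw [map_add, map_add, hs, ht]
  | tmul x w =>
    let Φ : C ⊗[k] (C ⊗[k] C) →ₗ[k] C ⊗[k] W :=
      (TensorProduct.lift f ∘ₗ (g.flip w).lTensor C).lTensor C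
    have hΦ : ∀ a b c, Φ (a ⊗ₜ (b ⊗ₜ c)) = a ⊗ₜ f b (g c w) := fun a b c => rfl
    have h1 := congrArg Φ (sum_tmul_tmul_eq (ℛ k x) (fun i => ℛ k ((ℛ k x).left i))
      (fun i => ℛ k ((ℛ k x).right i)))
    have h2 := congrArg ((LinearMap.toSpanSingleton k W w).lTensor C)
      (sum_tmul_counit_eq (ℛ k x))
    simp only [map_sum, LinearMap.lTensor_tmul, LinearMap.toSpanSingleton_apply, one_smul] at h2
    simp only [map_sum, hΦ] at h1
    rw [comulRight_tmul g (ℛ k x), map_sum, ← h2]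
    simp only [comulRight_tmul f (ℛ k _)]
    rw [h1]
    exact Finset.sum_congr rfl fun i _ => by rw [← TensorProduct.tmul_sum, h]

/-- `x ⊗ w ↦ x₃ ⊗ f(x₂) g(x₁) w` is the identity if `f(x₂) g(x₁) = ε(x)`. -/
lemma comulLeft_comulLeft {f g : C →ₗ[k] Module.End k W}
    (h : ∀ x w, ∑ i ∈ (ℛ k x).index, f ((ℛ k x).right i) (g ((ℛ k x).left i) w) =
      counit (R := k) x • w) (t : C ⊗[k] W) : comulLeft f (comulLeft g t) = t := by
  induction t with
  | zero => simp
  | add s t hs ht => rw [map_add, map_add, hs, ht]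
  | tmul x w =>
    let Φ : C ⊗[k] (C ⊗[k] C) →ₗ[k] C ⊗[k] W :=
      (TensorProduct.lift f ∘ₗ (g.flip w).lTensor C).lTensor C ∘ₗ
        (TensorProduct.assoc k C C C).toLinearMap ∘ₗ
        ((TensorProduct.comm k C C).toLinearMap.rTensor C) ∘ₗ
        (TensorProduct.comm k C (C ⊗[k] C)).toLinearMap
    have hΦ : ∀ a b c, Φ (a ⊗ₜ (b ⊗ₜ c)) = c ⊗ₜ f b (g a w) := fun a b c => rfl
    have h1 := congrArg Φ (sum_tmul_tmul_eq (ℛ k x) (fun i => ℛ k ((ℛ k x).left i))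
      (fun i => ℛ k ((ℛ k x).right i)))
    have h2 := congrArg ((LinearMap.toSpanSingleton k W w).lTensor C ∘
      TensorProduct.comm k k C) (sum_counit_tmul_eq (ℛ k x))
    simp only [Function.comp_apply, map_sum, TensorProduct.comm_tmul, LinearMap.lTensor_tmul,
      LinearMap.toSpanSingleton_apply, one_smul] at h2
    simp only [map_sum, hΦ] at h1
    rw [comulLeft_tmul g (ℛ k x), map_sum, ← h2]
    simp only [comulLeft_tmul f (ℛ k _)]
    rw [← h1]
    exact Finset.sum_congr rfl fun i _ => by rw [← TensorProduct.tmul_sum, h]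

lemma comulRight_bijective {f g : C →ₗ[k] Module.End k W}
    (hfg : ∀ x w, ∑ i ∈ (ℛ k x).index, f ((ℛ k x).left i) (g ((ℛ k x).right i) w) =
      counit (R := k) x • w)
    (hgf : ∀ x w, ∑ i ∈ (ℛ k x).index, g ((ℛ k x).left i) (f ((ℛ k x).right i) w) =
      counit (R := k) x • w) : Function.Bijective (comulRight f) :=
  Function.bijective_iff_has_inverse.2
    ⟨comulRight g, comulRight_comulRight hgf, comulRight_comulRight hfg⟩

lemma comulLeft_bijective {f g : C →ₗ[k] Module.End k W}
    (hfg : ∀ x w, ∑ i ∈ (ℛ k x).index, f ((ℛ k x).right i) (g ((ℛ k x).left i) w) =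
      counit (R := k) x • w)
    (hgf : ∀ x w, ∑ i ∈ (ℛ k x).index, g ((ℛ k x).right i) (f ((ℛ k x).left i) w) =
      counit (R := k) x • w) : Function.Bijective (comulLeft f) :=
  Function.bijective_iff_has_inverse.2
    ⟨comulLeft g, comulLeft_comulLeft hgf, comulLeft_comulLeft hfg⟩

end Convolution

/-! ### Bijections of `H ⊗ H` given by the antipode -/

section Hopf

open Coalgebra HopfAlgebra

variable (k H : Type u) [Field k] [Ring H] [HopfAlgebra k H]

/-- Left multiplications on `H`. -/
abbrev lmulHom : H →ₗ[k] Module.End k H := LinearMap.mul k H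

/-- Right multiplications on `H`. -/
abbrev rmulHom : H →ₗ[k] Module.End k H := (LinearMap.mul k H).flip

variable {k H}

lemma sum_mul_antipode_mul (x w : H) : ∑ i ∈ (ℛ k x).index,
    (ℛ k x).left i * (antipode k ((ℛ k x).right i) * w) = counit (R := k) x • w := by
  simp only [← mul_assoc]
  rw [← Finset.sum_mul, sum_mul_antipode_eq_smul, smul_one_mul]

lemma sum_antipode_mul_mul (x w : H) : ∑ i ∈ (ℛ k x).index,
    antipode k ((ℛ k x).left i) * ((ℛ k x).right i * w) = counit (R := k) x • w := by
  simp only [← mul_assoc]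
  rw [← Finset.sum_mul, sum_antipode_mul_eq_smul, smul_one_mul]

lemma sum_mul_mul_antipode (x w : H) : ∑ i ∈ (ℛ k x).index,
    w * (ℛ k x).left i * antipode k ((ℛ k x).right i) = counit (R := k) x • w := by
  simp only [mul_assoc]
  rw [← Finset.mul_sum, sum_mul_antipode_eq_smul, mul_smul_one]

lemma sum_mul_antipode_mul_right (x w : H) : ∑ i ∈ (ℛ k x).index,
    w * antipode k ((ℛ k x).left i) * (ℛ k x).right i = counit (R := k) x • w := by
  simp only [mul_assoc]
  rw [← Finset.mul_sum, sum_antipode_mul_eq_smul, mul_smul_one]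

/-- `S(x₂) S²(x₁) = S(S(x₁) x₂) = ε(x)`. -/
lemma sum_antipode_mul_antipodeSq (x : H) : ∑ i ∈ (ℛ k x).index,
    antipode k ((ℛ k x).right i) * antipode k (antipode k ((ℛ k x).left i)) =
      counit (R := k) x • 1 := by
  simp only [← antipode_mul_antidistrib, ← map_sum]
  rw [sum_antipode_mul_eq_smul, map_smul, antipode_one]

/-- `S²(x₂) S(x₁) = S(x₁ S(x₂)) = ε(x)`. -/
lemma sum_antipodeSq_mul_antipode (x : H) : ∑ i ∈ (ℛ k x).index,
    antipode k (antipode k ((ℛ k x).right i)) * antipode k ((ℛ k x).left i) =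
      counit (R := k) x • 1 := by
  simp only [← antipode_mul_antidistrib, ← map_sum]
  rw [sum_mul_antipode_eq_smul, map_smul, antipode_one]

variable (k H)

/-- The operator `x ⊗ y ↦ x₁ ⊗ x₂ y` is inverse to `x ⊗ y ↦ x₁ ⊗ S(x₂) y`. -/
lemma comulRight_lmul (t : H ⊗[k] H) :
    comulRight (lmulHom k H) (comulRight (lmulHom k H ∘ₗ antipode k) t) = t :=
  comulRight_comulRight (fun x w => sum_mul_antipode_mul x w) t

lemma comulRight_lmul_bijective : Function.Bijective (comulRight (lmulHom k H)) :=
  comulRight_bijective (g := lmulHom k H ∘ₗ antipode k)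
    (fun x w => sum_mul_antipode_mul x w) (fun x w => sum_antipode_mul_mul x w)

/-- The operator `x ⊗ y ↦ x₁ ⊗ y S(x₂)` is inverse to `x ⊗ y ↦ x₁ ⊗ y S²(x₂)`. -/
lemma comulRight_rmul_antipode (t : H ⊗[k] H) :
    comulRight (rmulHom k H ∘ₗ antipode k)
      (comulRight (rmulHom k H ∘ₗ antipode k ∘ₗ antipode k) t) = t :=
  comulRight_comulRight (fun x w => by
    change ∑ i ∈ (ℛ k x).index, w * _ * _ = _
    simp only [mul_assoc, LinearMap.comp_apply]
    rw [← Finset.mul_sum, sum_antipodeSq_mul_antipode, mul_smul_one]) t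

lemma comulRight_rmul_antipode_bijective :
    Function.Bijective (comulRight (rmulHom k H ∘ₗ antipode k)) :=
  Function.bijective_iff_has_inverse.2 ⟨_, comulRight_comulRight (fun x w => by
    change ∑ i ∈ (ℛ k x).index, w * _ * _ = _
    simp only [mul_assoc, LinearMap.comp_apply]
    rw [← Finset.mul_sum, sum_antipode_mul_antipodeSq, mul_smul_one]),
      comulRight_rmul_antipode k H⟩

/-- The operator `x ⊗ y ↦ x₂ ⊗ y x₁` is inverse to `x ⊗ y ↦ x₂ ⊗ y S(x₁)`. -/
lemma comulLeft_rmul (t : H ⊗[k] H) :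
    comulLeft (rmulHom k H) (comulLeft (rmulHom k H ∘ₗ antipode k) t) = t :=
  comulLeft_comulLeft (fun x w => sum_mul_antipode_mul_right x w) t

lemma comulLeft_rmul_bijective : Function.Bijective (comulLeft (rmulHom k H)) :=
  comulLeft_bijective (g := rmulHom k H ∘ₗ antipode k)
    (fun x w => sum_mul_antipode_mul_right x w) (fun x w => sum_mul_mul_antipode x w)

/-- The operator `x ⊗ y ↦ x₂ ⊗ S(x₁) y` is inverse to `x ⊗ y ↦ x₂ ⊗ S²(x₁) y`. -/
lemma comulLeft_lmul_antipode (t : H ⊗[k] H) :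
    comulLeft (lmulHom k H ∘ₗ antipode k)
      (comulLeft (lmulHom k H ∘ₗ antipode k ∘ₗ antipode k) t) = t :=
  comulLeft_comulLeft (fun x w => by
    change ∑ i ∈ (ℛ k x).index, _ * (_ * w) = _
    simp only [← mul_assoc, LinearMap.comp_apply]
    rw [← Finset.sum_mul, sum_antipode_mul_antipodeSq, smul_one_mul]) t

lemma comulLeft_lmul_antipode_bijective :
    Function.Bijective (comulLeft (lmulHom k H ∘ₗ antipode k)) :=
  Function.bijective_iff_has_inverse.2 ⟨_, comulLeft_comulLeft (fun x w => by
    change ∑ i ∈ (ℛ k x).index, _ * (_ * w) = _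
    simp only [← mul_assoc, LinearMap.comp_apply]
    rw [← Finset.sum_mul, sum_antipodeSq_mul_antipode, smul_one_mul]),
      comulLeft_lmul_antipode k H⟩

/-! ### The bimodule structures on `N ⊗ H` -/

/-- `a ⊗ b ↦ a₁ ⊗ (y ↦ a₂ y b)`: the homomorphism giving the bimodule structure
`a (n ⊗ y) b = a₁ n ⊗ a₂ y b` on `N ⊗ H`, for a left `H`-module `N`. -/
def leftAct : Env k H →ₐ[k] H ⊗[k] Module.End k H :=
  Algebra.TensorProduct.lift
    ((Algebra.TensorProduct.map (AlgHom.id k H) (Algebra.lmul k H)).comp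
      (Bialgebra.comulAlgHom k H))
    (Algebra.TensorProduct.includeRight.comp (Algebra.lsmul k k H))
    (fun a b => by
      generalize ha : Bialgebra.comulAlgHom k H a = t
      rw [AlgHom.comp_apply, ha]
      clear ha
      induction t with
      | zero => simp
      | add s t hs ht => rw [map_add]; exact hs.add_left ht
      | tmul x y =>
        induction b using MulOpposite.rec' with
        | _ b =>
        rw [Algebra.TensorProduct.map_tmul]
        change _ * _ = _ * _
        simp only [AlgHom.comp_apply, Algebra.TensorProduct.includeRight_apply,
          Algebra.TensorProduct.tmul_mul_tmul, mul_one, one_mul]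
        congr 1
        ext z
        simp [mul_assoc])

variable {k H} in
lemma leftAct_tmul (a b : H) {ι : Type*} (r : Repr k a ι) :
    leftAct k H (a ⊗ₜ op b) = ∑ i ∈ r.index, r.left i ⊗ₜ[k]
      (Algebra.lmul k H (r.right i) * Algebra.lsmul k k H (op b)) := by
  have h : Bialgebra.comulAlgHom k H a = ∑ i ∈ r.index, r.left i ⊗ₜ[k] r.right i := by
    rw [Bialgebra.comulAlgHom_apply, ← r.eq]
  simp [leftAct, h, Finset.sum_mul]

lemma tensorRep_leftAct {Z : Type u} [AddCommGroup Z] [Module k Z] (σ : H →ₐ[k] Module.End k Z)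
    (a b : H) {ι : Type*} (r : Repr k a ι) (z : Z) (w : H) :
    tensorRep (leftAct k H) σ (a ⊗ₜ op b) (z ⊗ₜ w) =
      ∑ i ∈ r.index, σ (r.left i) z ⊗ₜ[k] (r.right i * (w * b)) :=
  tensorRep_tmul _ _ (leftAct_tmul a b r) z w

/-- The comultiplication `b ↦ b₂ ⊗ b₁` of the opposite algebra. -/
def comulOp : Hᵐᵒᵖ →ₐ[k] Hᵐᵒᵖ ⊗[k] Hᵐᵒᵖ :=
  (Algebra.TensorProduct.comm k Hᵐᵒᵖ Hᵐᵒᵖ).toAlgHom.comp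
    ((Algebra.TensorProduct.opAlgEquiv k k H H).symm.toAlgHom.comp
      (Bialgebra.comulAlgHom k H).op)

variable {k H} in
lemma comulOp_apply (b : H) {ι : Type*} (r : Repr k b ι) :
    comulOp k H (op b) = ∑ i ∈ r.index, op (r.right i) ⊗ₜ[k] op (r.left i) := by
  have h : (Bialgebra.comulAlgHom k H).op (op b) =
      ∑ i ∈ r.index, op (r.left i ⊗ₜ[k] r.right i) := by
    rw [AlgHom.op_apply_apply, unop_op, Bialgebra.comulAlgHom_apply, ← r.eq]
    exact map_sum (opAddEquiv : H ⊗[k] H ≃+ (H ⊗[k] H)ᵐᵒᵖ) _ _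
  simp [comulOp, h]

/-- `a ⊗ b ↦ b₂ ⊗ (y ↦ a y b₁)`: the homomorphism giving the bimodule structure
`a (n ⊗ y) b = n b₂ ⊗ a y b₁` on `N ⊗ H`, for a right `H`-module `N`. -/
def rightAct : Env k H →ₐ[k] Hᵐᵒᵖ ⊗[k] Module.End k H :=
  Algebra.TensorProduct.lift
    (Algebra.TensorProduct.includeRight.comp (Algebra.lmul k H))
    ((Algebra.TensorProduct.map (AlgHom.id k Hᵐᵒᵖ) (Algebra.lsmul k k H)).comp (comulOp k H))
    (fun a b => by
      generalize hb : comulOp k H b = t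
      rw [AlgHom.comp_apply (Algebra.TensorProduct.map _ _), hb]
      clear hb
      induction t with
      | zero => simp
      | add s t hs ht => rw [map_add]; exact hs.add_right ht
      | tmul x y =>
        rw [Algebra.TensorProduct.map_tmul]
        change _ * _ = _ * _
        simp only [AlgHom.comp_apply, Algebra.TensorProduct.includeRight_apply,
          Algebra.TensorProduct.tmul_mul_tmul, mul_one, one_mul]
        congr 1
        ext z
        simp [mul_assoc])

variable {k H} in
lemma rightAct_tmul (a b : H) {ι : Type*} (r : Repr k b ι) :
    rightAct k H (a ⊗ₜ op b) = ∑ i ∈ r.index, op (r.right i) ⊗ₜ[k]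
      (Algebra.lmul k H a * Algebra.lsmul k k H (op (r.left i))) := by
  simp [rightAct, comulOp_apply b r, Finset.mul_sum]

lemma tensorRep_rightAct {Z : Type u} [AddCommGroup Z] [Module k Z]
    (σ : Hᵐᵒᵖ →ₐ[k] Module.End k Z) (a b : H) {ι : Type*} (r : Repr k b ι) (z : Z) (w : H) :
    tensorRep (rightAct k H) σ (a ⊗ₜ op b) (z ⊗ₜ w) =
      ∑ i ∈ r.index, σ (op (r.right i)) z ⊗ₜ[k] (a * (w * r.left i)) :=
  tensorRep_tmul _ _ (rightAct_tmul a b r) z w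

end Hopf

/-! ### Comparison data of a Hopf algebra -/

section Main

open Coalgebra HopfAlgebra

variable (k H : Type u) [Field k] [Ring H] [HopfAlgebra k H]

lemma tensorRep_leftAct_one (t : Env k H) :
    tensorRep (leftAct k H) (Algebra.lsmul k k H) t (1 ⊗ₜ 1) =
      comulRight (lmulHom k H) ((opLinearEquiv k).symm.lTensor H t) := by
  induction t using TensorProduct.induction_on with
  | zero => simp
  | add s t hs ht => rw [map_add, map_add, map_add, LinearMap.add_apply, hs, ht]
  | tmul a b =>
    induction b using MulOpposite.rec' with
    | _ b =>
    rw [tensorRep_leftAct k H _ a b (ℛ k a)]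
    refine Eq.trans ?_ (comulRight_tmul (lmulHom k H) (ℛ k a) b).symm
    simp

/-- `x ↦ x₁ ⊗ S(x₂)`. -/
def leftBeta : H →ₗ[k] Env k H :=
  (opLinearEquiv k).toLinearMap.lTensor H ∘ₗ comulRight (lmulHom k H ∘ₗ antipode k) ∘ₗ
    (TensorProduct.mk k H H).flip 1

/-- `v ↦ 1 ⊗ v`. -/
def leftPhi : H →ₗ[k] Env k H := TensorProduct.mk k H Hᵐᵒᵖ 1 ∘ₗ (opLinearEquiv k).toLinearMap

lemma leftBeta_mul_leftPhi (t : H ⊗[k] H) :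
    TensorProduct.lift ((LinearMap.mul k (Env k H)).compl₁₂ (leftBeta k H) (leftPhi k H)) t =
      (opLinearEquiv k).lTensor H (comulRight (rmulHom k H ∘ₗ antipode k) t) := by
  induction t with
  | zero => simp
  | add s t hs ht => rw [map_add, map_add, map_add, hs, ht]
  | tmul x v =>
    rw [comulRight_tmul _ (ℛ k x)]
    simp [leftBeta, leftPhi, comulRight_tmul _ (ℛ k x)]

variable {k H} in
/-- `φ(v) (b ⊗ a) = ∑ β(b₁) φ(a v S²(b₂))`. -/
lemma leftPhi_mul (v a b : H) : leftPhi k H v * (b ⊗ₜ op a) =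
    ∑ i ∈ (ℛ k b).index, leftBeta k H ((ℛ k b).left i) *
      leftPhi k H (a * v * antipode k (antipode k ((ℛ k b).right i))) := by
  have h := leftBeta_mul_leftPhi k H
    (comulRight (rmulHom k H ∘ₗ antipode k ∘ₗ antipode k) (b ⊗ₜ (a * v)))
  rw [comulRight_rmul_antipode, comulRight_tmul _ (ℛ k b), map_sum] at h
  refine Eq.trans ?_ h.symm
  simp [leftPhi]

/-- For left modules, `x ⊗ 1 = (x₁ ⊗ S(x₂)) · (1 ⊗ 1)` in `H ⊗ H`, and `H ⊗ Hᵒᵖ` has a basis of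
elements `x₁ ⊗ v S(x₂)`. -/
def leftData : ComparisonData k H (Env k H) H H H where
  γ := leftAct k H
  z₀ := 1
  w₀ := 1
  β := leftBeta k H
  φ := leftPhi k H
  bijective_smul := by
    simp only [smul_eq_mul, mul_one]
    exact Function.bijective_id
  bijective_act := by
    simp only [tensorRep_leftAct_one]
    exact (comulRight_lmul_bijective k H).comp (LinearEquiv.bijective _)
  act_β z := by
    rw [tensorRep_leftAct_one]
    refine Eq.trans (congrArg _ ?_) (comulRight_lmul k H (z ⊗ₜ 1))
    exact ((opLinearEquiv k).lTensor H).symm_apply_apply _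
  bijective_mul := by
    rw [show ⇑(TensorProduct.lift _) = _ from funext (leftBeta_mul_leftPhi k H)]
    exact (LinearEquiv.bijective _).comp (comulRight_rmul_antipode_bijective k H)

lemma tensorRep_rightAct_one (t : Env k H) :
    tensorRep (rightAct k H) (Algebra.lsmul k k H) t (1 ⊗ₜ 1) =
      comulLeft (rmulHom k H) (TensorProduct.comm k H H ((opLinearEquiv k).symm.lTensor H t)) := by
  induction t using TensorProduct.induction_on with
  | zero => simp
  | add s t hs ht => rw [map_add, map_add, map_add, map_add, LinearMap.add_apply, hs, ht]
  | tmul a b =>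
    induction b using MulOpposite.rec' with
    | _ b =>
    rw [tensorRep_rightAct k H _ a b (ℛ k b)]
    refine Eq.trans ?_ (comulLeft_tmul (rmulHom k H) (ℛ k b) a).symm
    simp

/-- `x ↦ S(x₁) ⊗ x₂`. -/
def rightBeta : H →ₗ[k] Env k H :=
  (opLinearEquiv k).toLinearMap.lTensor H ∘ₗ (TensorProduct.comm k H H).toLinearMap ∘ₗ
    comulLeft (rmulHom k H ∘ₗ antipode k) ∘ₗ (TensorProduct.mk k H H).flip 1

/-- `v ↦ v ⊗ 1`. -/
def rightPhi : H →ₗ[k] Env k H := (TensorProduct.mk k H Hᵐᵒᵖ).flip 1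

lemma rightBeta_mul_rightPhi (t : H ⊗[k] H) :
    TensorProduct.lift ((LinearMap.mul k (Env k H)).compl₁₂ (rightBeta k H) (rightPhi k H)) t =
      (opLinearEquiv k).lTensor H (TensorProduct.comm k H H
        (comulLeft (lmulHom k H ∘ₗ antipode k) t)) := by
  induction t with
  | zero => simp
  | add s t hs ht => rw [map_add, map_add, map_add, map_add, hs, ht]
  | tmul x v =>
    rw [comulLeft_tmul _ (ℛ k x)]
    simp [rightBeta, rightPhi, comulLeft_tmul _ (ℛ k x)]

variable {k H} in
/-- `φ(v) (b ⊗ a) = ∑ β(a₂) φ(S²(a₁) v b)`. -/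
lemma rightPhi_mul (v a b : H) : rightPhi k H v * (b ⊗ₜ op a) =
    ∑ i ∈ (ℛ k a).index, rightBeta k H ((ℛ k a).right i) *
      rightPhi k H (antipode k (antipode k ((ℛ k a).left i)) * v * b) := by
  have h := rightBeta_mul_rightPhi k H
    (comulLeft (lmulHom k H ∘ₗ antipode k ∘ₗ antipode k) (a ⊗ₜ (v * b)))
  rw [comulLeft_lmul_antipode, comulLeft_tmul _ (ℛ k a), map_sum] at h
  refine Eq.trans ?_ (h.symm.trans (Finset.sum_congr rfl fun i _ => ?_))
  · simp [rightPhi]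
  · simp [mul_assoc]

/-- For right modules, `x ⊗ 1 = (S(x₁) ⊗ x₂) · (1 ⊗ 1)` in `H ⊗ H`, and `H ⊗ Hᵒᵖ` has a basis of
elements `S(x₁) v ⊗ x₂`. -/
def rightData : ComparisonData k Hᵐᵒᵖ (Env k H) H H H where
  γ := rightAct k H
  z₀ := 1
  w₀ := 1
  β := rightBeta k H
  φ := rightPhi k H
  bijective_smul := by
    have h : (fun r : Hᵐᵒᵖ => r • (1 : H)) = unop := by
      funext r
      rw [smul_eq_mul_unop, one_mul]
    rw [h]
    exact unop_bijective
  bijective_act := by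
    simp only [tensorRep_rightAct_one]
    exact (comulLeft_rmul_bijective k H).comp
      ((LinearEquiv.bijective _).comp (LinearEquiv.bijective _))
  act_β z := by
    rw [tensorRep_rightAct_one]
    refine Eq.trans (congrArg _ ?_) (comulLeft_rmul k H (z ⊗ₜ 1))
    refine (congrArg (TensorProduct.comm k H H)
      (((opLinearEquiv k).lTensor H).symm_apply_apply _)).trans ?_
    exact (TensorProduct.comm k H H).symm_apply_apply _
  bijective_mul := by
    rw [show ⇑(TensorProduct.lift _) = _ from funext (rightBeta_mul_rightPhi k H)]
    exact (LinearEquiv.bijective _).comp ((LinearEquiv.bijective _).comp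
      (comulLeft_lmul_antipode_bijective k H))

/-! ### The isomorphisms of bimodules -/

/-- `k ⊗ H` is the regular bimodule, for the trivial left module `k`. -/
def leftTrivialIso :
    (tensorFunctor (leftAct k H)).obj (leftTrivial k H) ≅ regularBimodule k H :=
  let σ := (Algebra.lmul k k).comp (Bialgebra.counitAlgHom k H)
  tensorFunctorIso _ σ (ofRep σ) (ofRepEquiv σ) (fun _ _ => rfl) ≪≫
    ofRepIso _ _ (TensorProduct.lid k H) fun t x => by
      induction t using TensorProduct.induction_on with
      | zero => simp
      | add s t hs ht => rw [map_add, map_add, LinearMap.add_apply, map_add, hs, ht]; rfl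
      | tmul a b =>
        induction b using MulOpposite.rec' with
        | _ b =>
        induction x with
        | zero => simp
        | add x y hx hy => rw [map_add, map_add, map_add, map_add, hx, hy]
        | tmul c w =>
          rw [tensorRep_leftAct k H _ a b (ℛ k a)]
          simp only [map_sum, TensorProduct.lid_tmul, AlgHom.mulLeftRight_apply, unop_op]
          conv_rhs => rw [← sum_counit_smul (ℛ k a)]
          simp only [Finset.sum_mul, smul_mul_assoc, mul_smul_comm, Finset.smul_sum, smul_smul,
            mul_assoc]
          exact Finset.sum_congr rfl fun i _ => congrArg (· • _) (mul_comm _ _)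

/-- `k ⊗ H` is the regular bimodule, for the trivial right module `k`. -/
def rightTrivialIso :
    (tensorFunctor (rightAct k H)).obj (rightTrivial k H) ≅ regularBimodule k H :=
  let σ := (Algebra.lmul k k).comp
    ((Bialgebra.counitAlgHom k H).fromOpposite fun _ _ => Commute.all _ _)
  tensorFunctorIso _ σ (ofRep σ) (ofRepEquiv σ) (fun _ _ => rfl) ≪≫
    ofRepIso _ _ (TensorProduct.lid k H) fun t x => by
      induction t using TensorProduct.induction_on with
      | zero => simp
      | add s t hs ht => rw [map_add, map_add, LinearMap.add_apply, map_add, hs, ht]; rfl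
      | tmul a b =>
        induction b using MulOpposite.rec' with
        | _ b =>
        induction x with
        | zero => simp
        | add x y hx hy => rw [map_add, map_add, map_add, map_add, hx, hy]
        | tmul c w =>
          rw [tensorRep_rightAct k H _ a b (ℛ k b)]
          have hb : ∑ i ∈ (ℛ k b).index, counit (R := k) ((ℛ k b).right i) • (ℛ k b).left i = b := by
            have h := congrArg (TensorProduct.rid k H) (sum_tmul_counit_eq (ℛ k b))
            rw [map_sum] at h
            simp only [TensorProduct.rid_tmul, one_smul] at h
            exact h
          simp only [map_sum, TensorProduct.lid_tmul, AlgHom.mulLeftRight_apply, unop_op]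
          conv_rhs => rw [← hb]
          simp only [Finset.mul_sum, smul_mul_assoc, mul_smul_comm, smul_smul,
            mul_assoc]
          exact Finset.sum_congr rfl fun i _ => rfl

/-- Precomposition with an isomorphism, as a linear isomorphism between `Ext` groups. -/
def extIsoLeft {R : Type u} [Ring R] [Algebra k R] {X X' : ModuleCat.{u} R} (j : X ≅ X')
    (Y : ModuleCat.{u} R) (n : ℕ) : Ext X Y n ≃ₗ[k] Ext X' Y n :=
  LinearEquiv.ofLinearMap ((Ext.mk₀ j.inv).precompOfLinear k Y (zero_add n))
    ((Ext.mk₀ j.hom).precompOfLinear k Y (zero_add n)) (by ext; simp) (by ext; simp)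

lemma extIsoLeft_comp {R : Type u} [Ring R] [Algebra k R] {X X' : ModuleCat.{u} R} (j : X ≅ X')
    {Y : ModuleCat.{u} R} {n : ℕ} (e : Ext X Y n) (f : Y ⟶ Y) :
    (extIsoLeft k j Y n e).comp (Ext.mk₀ f) (add_zero n) =
      extIsoLeft k j Y n (e.comp (Ext.mk₀ f) (add_zero n)) :=
  Ext.comp_assoc_of_third_deg_zero _ _ _ (zero_add n)

variable {k H}

/-- The action of the bimodule `Ext_{H^e}(H, H^e)`. -/
lemma hochschild_apply (n : ℕ) (a b : H)
    (e : Ext (regularBimodule k H) (ModuleCat.of (Env k H) (Env k H)) n) :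
    ((extRep (k := k) (regularBimodule k H) (Env k H)ᵐᵒᵖ (Env k H) n).comp (envFlip k H))
      (a ⊗ₜ op b) e = e.comp (Ext.mk₀ (actHom (Env k H) (op (b ⊗ₜ[k] op a)))) (add_zero n) := rfl

/-- Intertwining relations may be checked on pure tensors. -/
lemma intertwine_of_tmul {E F G : Type u} [AddCommGroup E] [Module k E] [AddCommGroup F]
    [Module k F] [AddCommGroup G] [Module k G] (ρ : Env k H →ₐ[k] Module.End k (E ⊗[k] F))
    (ρ' : Env k H →ₐ[k] Module.End k G) (f : E ⊗[k] F →ₗ[k] G)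
    (h : ∀ a b x y, f (ρ (a ⊗ₜ op b) (x ⊗ₜ y)) = ρ' (a ⊗ₜ op b) (f (x ⊗ₜ y))) (t : Env k H)
    (x : E ⊗[k] F) : f (ρ t x) = ρ' t (f x) := by
  induction t using TensorProduct.induction_on with
  | zero => simp
  | add s t hs ht => rw [map_add, map_add, LinearMap.add_apply, map_add, hs, ht]; rfl
  | tmul a b =>
    induction b using MulOpposite.rec' with
    | _ b =>
    induction x with
    | zero => simp
    | add x y hx hy => rw [map_add, map_add, map_add, map_add, hx, hy]
    | tmul x y => exact h a b x y

/-- The isomorphism `Ext_H(k, H) ⊗ H ≃ Ext_{H^e}(H, H^e)` of vector spaces. -/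
def leftEquiv (n : ℕ) (hb : Function.Bijective ((leftData k H).compare (leftTrivial k H) n)) :
    Ext (leftTrivial k H) (ModuleCat.of H H) n ⊗[k] H ≃ₗ[k]
      Ext (regularBimodule k H) (ModuleCat.of (Env k H) (Env k H)) n :=
  (LinearEquiv.ofBijective _ hb).trans (extIsoLeft k (leftTrivialIso k H) _ n)

lemma leftEquiv_apply (n : ℕ)
    (hb : Function.Bijective ((leftData k H).compare (leftTrivial k H) n))
    (t : Ext (leftTrivial k H) (ModuleCat.of H H) n ⊗[k] H) :
    leftEquiv n hb t =
      extIsoLeft k (leftTrivialIso k H) _ n ((leftData k H).compare (leftTrivial k H) n t) := rfl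

/-- The bimodule structure of `Ext_{H^e}(k ⊗ H, H^e)` corresponds to the twisted one of
`Ext_H(k, H) ⊗ H`. -/
lemma leftCompare_comp (n : ℕ) (a b : H) (x : Ext (leftTrivial k H) (ModuleCat.of H H) n)
    (y : H) :
    ((leftData k H).compare (leftTrivial k H) n (x ⊗ₜ y)).comp
        (Ext.mk₀ (actHom (Env k H) (op (b ⊗ₜ[k] op a)))) (add_zero n) =
      (leftData k H).compare (leftTrivial k H) n
        (twistRightRep (leftExtRep k H n) (a ⊗ₜ op b) (x ⊗ₜ y)) := by
  rw [twistRightRep_tmul _ a b (ℛ k b), map_sum]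
  refine (leftData k H).compare_comp x y (b ⊗ₜ op a) (ℛ k b).index (fun i => op ((ℛ k b).left i))
    (fun i => a * y * antipode k (antipode k ((ℛ k b).right i)))
    ((leftPhi_mul y a b).trans (Finset.sum_congr rfl fun i _ => ?_))
  exact congrArg (fun z => leftBeta k H z * _) (one_mul ((ℛ k b).left i)).symm

lemma leftEquiv_intertwine (n : ℕ)
    (hb : Function.Bijective ((leftData k H).compare (leftTrivial k H) n)) (a b : H)
    (x : Ext (leftTrivial k H) (ModuleCat.of H H) n) (y : H) :
    leftEquiv n hb (twistRightRep (leftExtRep k H n) (a ⊗ₜ op b) (x ⊗ₜ y)) =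
      ((extRep (k := k) (regularBimodule k H) (Env k H)ᵐᵒᵖ (Env k H) n).comp (envFlip k H))
        (a ⊗ₜ op b) (leftEquiv n hb (x ⊗ₜ y)) := by
  rw [hochschild_apply, leftEquiv_apply, leftEquiv_apply]
  exact (congrArg (extIsoLeft k (leftTrivialIso k H) _ n) (leftCompare_comp n a b x y).symm).trans
    (extIsoLeft_comp k (leftTrivialIso k H) _ _).symm

theorem nonempty_hochschild_iso_left (hfp : ∀ m, IsFP H m (leftTrivial k H)) (n : ℕ) :
    Nonempty (hochschildBimodule k H n ≅ leftExtBimodule k H n) :=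
  have hb : Function.Bijective ((leftData k H).compare (leftTrivial k H) n) :=
    (leftData k H).compare_bijective (leftTrivial k H) hfp n
  ⟨(ofRepIso (twistRightRep (leftExtRep k H n)) _ (leftEquiv n hb)
    (intertwine_of_tmul _ _ (leftEquiv n hb).toLinearMap (leftEquiv_intertwine n hb))).symm⟩

/-- The isomorphism `H ⊗ Ext_{Hᵒᵖ}(k, H) ≃ Ext_{H^e}(H, H^e)` of vector spaces. -/
def rightEquiv (n : ℕ) (hb : Function.Bijective ((rightData k H).compare (rightTrivial k H) n)) :
    H ⊗[k] Ext (rightTrivial k H) (ModuleCat.of Hᵐᵒᵖ H) n ≃ₗ[k]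
      Ext (regularBimodule k H) (ModuleCat.of (Env k H) (Env k H)) n :=
  (TensorProduct.comm k _ _).trans
    ((LinearEquiv.ofBijective _ hb).trans (extIsoLeft k (rightTrivialIso k H) _ n))

lemma rightEquiv_apply (n : ℕ)
    (hb : Function.Bijective ((rightData k H).compare (rightTrivial k H) n))
    (t : H ⊗[k] Ext (rightTrivial k H) (ModuleCat.of Hᵐᵒᵖ H) n) :
    rightEquiv n hb t = extIsoLeft k (rightTrivialIso k H) _ n
      ((rightData k H).compare (rightTrivial k H) n (TensorProduct.comm k _ _ t)) := rfl

/-- The bimodule structure of `Ext_{H^e}(k ⊗ H, H^e)` corresponds to the twisted one of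
`H ⊗ Ext_{Hᵒᵖ}(k, H)`. -/
lemma rightCompare_comp (n : ℕ) (a b : H)
    (x : Ext (rightTrivial k H) (ModuleCat.of Hᵐᵒᵖ H) n) (y : H) :
    ((rightData k H).compare (rightTrivial k H) n (x ⊗ₜ y)).comp
        (Ext.mk₀ (actHom (Env k H) (op (b ⊗ₜ[k] op a)))) (add_zero n) =
      (rightData k H).compare (rightTrivial k H) n (TensorProduct.comm k _ _
        (twistLeftRep (rightExtRep k H n) (a ⊗ₜ op b) (y ⊗ₜ x))) := by
  rw [twistLeftRep_tmul _ a b (ℛ k a), map_sum, map_sum]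
  refine (rightData k H).compare_comp x y (b ⊗ₜ op a) (ℛ k a).index (fun i => (ℛ k a).right i)
    (fun i => antipode k (antipode k ((ℛ k a).left i)) * y * b)
    ((rightPhi_mul y a b).trans (Finset.sum_congr rfl fun i _ => ?_))
  exact congrArg (fun z => rightBeta k H z * _) (mul_one ((ℛ k a).right i)).symm

lemma rightEquiv_intertwine (n : ℕ)
    (hb : Function.Bijective ((rightData k H).compare (rightTrivial k H) n)) (a b : H) (y : H)
    (x : Ext (rightTrivial k H) (ModuleCat.of Hᵐᵒᵖ H) n) :
    rightEquiv n hb (twistLeftRep (rightExtRep k H n) (a ⊗ₜ op b) (y ⊗ₜ x)) =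
      ((extRep (k := k) (regularBimodule k H) (Env k H)ᵐᵒᵖ (Env k H) n).comp (envFlip k H))
        (a ⊗ₜ op b) (rightEquiv n hb (y ⊗ₜ x)) := by
  rw [hochschild_apply, rightEquiv_apply, rightEquiv_apply]
  exact (congrArg (extIsoLeft k (rightTrivialIso k H) _ n)
    (rightCompare_comp n a b x y).symm).trans
    (extIsoLeft_comp k (rightTrivialIso k H) _ _).symm

theorem nonempty_hochschild_iso_right (hfp : ∀ m, IsFP Hᵐᵒᵖ m (rightTrivial k H)) (n : ℕ) :
    Nonempty (hochschildBimodule k H n ≅ rightExtBimodule k H n) :=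
  have hb : Function.Bijective ((rightData k H).compare (rightTrivial k H) n) :=
    (rightData k H).compare_bijective (rightTrivial k H) hfp n
  ⟨(ofRepIso (twistLeftRep (rightExtRep k H n)) _ (rightEquiv n hb)
    (intertwine_of_tmul _ _ (rightEquiv n hb).toLinearMap (rightEquiv_intertwine n hb))).symm⟩

lemma nontrivial_of_hopfAlgebra (k H : Type u) [Field k] [Ring H] [HopfAlgebra k H] :
    Nontrivial H :=
  (Bialgebra.counitAlgHom k H).toRingHom.domain_nontrivial

lemma isFP_leftTrivial_iff (n : ℕ) :
    IsFP (Env k H) n (regularBimodule k H) ↔ IsFP H n (leftTrivial k H) := by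
  have := nontrivial_of_hopfAlgebra k H
  rw [← (leftData k H).isFP_map_iff (leftTrivial k H) n]
  exact ⟨fun h => h.of_equiv (leftTrivialIso k H).toLinearEquiv.symm,
    fun h => h.of_equiv (leftTrivialIso k H).toLinearEquiv⟩

lemma isFP_rightTrivial_iff (n : ℕ) :
    IsFP (Env k H) n (regularBimodule k H) ↔ IsFP Hᵐᵒᵖ n (rightTrivial k H) := by
  have := nontrivial_of_hopfAlgebra k H
  rw [← (rightData k H).isFP_map_iff (rightTrivial k H) n]
  exact ⟨fun h => h.of_equiv (rightTrivialIso k H).toLinearEquiv.symm,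
    fun h => h.of_equiv (rightTrivialIso k H).toLinearEquiv⟩

end Main
end HopfBimodule

end

theorem theorem2p5 {k H : Type u} [Field k] [Ring H] [HopfAlgebra k H]
    (hres : HopfBimodule.HasFGProjectiveResolution (HopfBimodule.regularBimodule k H) ∨
      HopfBimodule.HasFGProjectiveResolution (HopfBimodule.leftTrivial k H) ∨
      HopfBimodule.HasFGProjectiveResolution (HopfBimodule.rightTrivial k H))
    (i : ℕ) :
    Nonempty (HopfBimodule.hochschildBimodule k H i ≅ HopfBimodule.leftExtBimodule k H i) ∧
    Nonempty (HopfBimodule.leftExtBimodule k H i ≅ HopfBimodule.rightExtBimodule k H i) := by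
  have hreg : ∀ n, HopfBimodule.IsFP (HopfBimodule.Env k H) n
      (HopfBimodule.regularBimodule k H) := by
    intro n
    rcases hres with h | h | h
    · exact HopfBimodule.IsFP.of_hasFGProjectiveResolution h n
    · exact (HopfBimodule.isFP_leftTrivial_iff n).2
        (HopfBimodule.IsFP.of_hasFGProjectiveResolution h n)
    · exact (HopfBimodule.isFP_rightTrivial_iff n).2
        (HopfBimodule.IsFP.of_hasFGProjectiveResolution h n)
  obtain ⟨e⟩ := HopfBimodule.nonempty_hochschild_iso_left
    (fun n => (HopfBimodule.isFP_leftTrivial_iff n).1 (hreg n)) i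
  obtain ⟨e'⟩ := HopfBimodule.nonempty_hochschild_iso_right
    (fun n => (HopfBimodule.isFP_rightTrivial_iff n).1 (hreg n)) i
  exact ⟨⟨e⟩, ⟨e.symm ≪≫ e'⟩⟩
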